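/- Let $(P,<)$ be a finite poset and $P^*\subseteq P$ a subset (of marked elements) containing all minimal and all maximal elements. Write $\mathcal J$ and $\mathcal J^*$ for the sets of order ideals (lower sets) of $(P,<)$ and of $(P^*,<)$; for a set $A$ let $\mathbf 1_A$ be its indicator vector, and $\omega_K=\mathbf 1_K\in\mathbb Z^{P^*}$ for $K\in\mathcal J^*$. A marking $\lambda\in\mathbb Z^{P^*}$ is dominant if $\lambda_p\ge\lambda_q$ for all $p<q$ in $P^*$. For a strict order $\prec$ on $P$ and $J\subseteq P$ let $\max_\prec J$ be the set of $\prec$-maximal elements of $J$, and let $J_1*_\prec J_2$ be the order ideal of $(P,\prec)$ generated by $(J_1\cap J_2)\cap(\max_\prec J_1\cup\max_\prec J_2)$. A strict order $<'$ on $P$ is called admissible if (i) $p<'q$ implies $p<q$; (ii) $J_1*_{<'}J_2\in\mathcal J$ for all $J_1,J_2\in\mathcal J$; (iii) $p\not<'q$ for all $p\in P^*$, $q\in P$. For such $<'$ and $K\in\mathcal J^*$ let $\mathcal R_{\omega_K}(P,<,<')\subset\mathbb R^P$ be the convex hull of the points $\mathbf 1_{\max_{<'}J}$ with $J\in\mathcal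 J$, $J\cap P^*=K$. Every nonnegative dominant marking has a unique expression $\mu=\sum_K\alpha_K(\mu)\,\omega_K$ with $\alpha_K(\mu)\in\mathbb Z_{\ge0}$, $\alpha_\varnothing(\mu)=0$ and $\{K\in\mathcal J^*:\alpha_K(\mu)\ne0\}$ a chain, and one defines the marked relative poset polytope (MRPP) as the Minkowski sum $\mathcal R_\mu(P,<,<')=\sum_{K\in\mathcal J^*}\alpha_K(\mu)\mathcal R_{\omega_K}(P,<,<')$. For a dominant $\lambda$ with negative coordinates one sets $\mathcal R_\lambda(P,<,<')=\mathcal R_{\lambda+\beta\omega_{P^*}}(P,<,<')-\beta\mathbf 1_{\max_{<'}P}$ for an integer $\beta$ such that $\lambda+\beta\omega_{P^*}$ is nonnegative. For a partition $P\setminus P^*=C\sqcup O$ and a dominant marking $\lambda$, the marked chain-order polytope $\mathcal O_{C,O}(P,<,\lambda)\subset\mathbb R^P$ consists of all $x$ with $x_p=\lambda_p$ for $p\in P^*$, $x_p\ge0$ for $p\in C$, and $x_{p_1}+\dots+x_{p_r}\le x_a-x_b$ for every chain $a<p_1<\dots<p_r<b$ with $r\ge0$, $a,b\in P^*\sqcup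 O$ and all $p_i\in C$. **Theorem.** Let $p<'q$ if and only if $p<q$ and $p\notin P^*\cup O$. Then $<'$ is an admissible order and $$\mathcal O_{C,O}(P,<,\lambda)=\mathcal R_\lambda(P,<,<'),$$ where for the right-hand side every integer $\beta$ with $\lambda+\beta\omega_{P^*}$ nonnegative may be used. **Corollary.** Let $n\ge1$ and $\mathbf d=\{d_0<\dots<d_l\}$ with $d_0=0$, $d_l=n$. Let $P_{\mathbf d}$ consist of the elements $\tilde p_k=p_{d_{k-1}+1,d_k}$ ($1\le k\le l$) and all $p_{i,j}$ with $1\le i\le d_m<j\le n$ for some $1\le m\le l-1$, ordered by $p_{i_1,j_1}\le p_{i_2,j_2}$ iff $i_1\le i_2$ and $j_1\le j_2$. Let $P_{\mathbf d}^*=\{\tilde p_1,\dots,\tilde p_l\}$, $K_k=\{\tilde p_1,\dots,\tilde p_k\}$ and $\lambda=\omega_{K_1}+\dots+\omega_{K_l}$ (so $\lambda_{\tilde p_k}=l+1-k$). Let $<_\varnothing$ be the trivial order (no relations), and let $p<'q$ iff $p<q$ and $p\notin P_{\mathbf d}^*$. Then $P^*_{\mathbf d}$ contains all minimal and maximal elements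 of $P_{\mathbf d}$, $\lambda$ is dominant, $<_\varnothing$ and $<'$ are admissible, and $$\mathcal R_\lambda(P_{\mathbf d},<,<_\varnothing)=\mathcal O_{\varnothing,P_{\mathbf d}\setminus P_{\mathbf d}^*}(P_{\mathbf d},<,\lambda),\qquad \mathcal R_\lambda(P_{\mathbf d},<,<')=\mathcal O_{P_{\mathbf d}\setminus P_{\mathbf d}^*,\varnothing}(P_{\mathbf d},<,\lambda).$$ These are the Gelfand–Tsetlin and the FFLV polytope of the $\mathfrak{gl}_n$-weight $\mu=\omega_{d_1}+\dots+\omega_{d_{l-1}}$, where $\omega_k=(1^k,0^{n-k})$, in the following sense. In the space of arrays $(z_{i,j})_{1\le i\le j\le n}$ let $GT(\mu)$ be given by $z_{i,i}=\mu_i$ and $z_{i,j}\ge z_{i,j+1}\ge z_{i+1,j+1}$, and let $FFLV(\mu)$ be given by $z_{i,i}=\mu_i$, $z_{i,j}\ge0$ for $i<j$, and $\sum_s z_{\beta_s}\le\mu_i-\mu_{j+1}$ for every Dyck path $\beta_1,\dots,\beta_r$, i.e. every sequence of pairs $(a,b)$ with $a<b$ from $(i,i+1)$ to $(j,j+1)$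 with steps $(a,b)\to(a,b+1)$ or $(a,b)\to(a+1,b)$. Then * $x\mapsto z$ with $z_{i,j}=x_{p_{i,j}}-1$ if $p_{i,j}\in P_{\mathbf d}\setminus P_{\mathbf d}^*$ and $z_{i,j}=\mu_i$ otherwise is a bijection $\mathcal R_\lambda(P_{\mathbf d},<,<_\varnothing)\to GT(\mu)$; * $x\mapsto z$ with $z_{i,j}=x_{p_{i,j}}$ if $p_{i,j}\in P_{\mathbf d}\setminus P_{\mathbf d}^*$, and otherwise $z_{i,i}=\mu_i$ and $z_{i,j}=0$ for $i<j$, is a bijection $\mathcal R_\lambda(P_{\mathbf d},<,<')\to FFLV(\mu)$. -/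

import Mathlib

open scoped Pointwise

namespace PosetPolytope

/-! ### Orders, ideals and maximal elements -/

/-- The set `max_r J` of maximal elements of `J` with respect to the strict relation `r`. -/
def maxSet {P : Type*} (r : P → P → Prop) (J : Set P) : Set P :=
  {p | p ∈ J ∧ ∀ q ∈ J, ¬ r p q}

/-- The indicator vector `1_A ∈ ℝ^P` of `A ⊆ P`. -/
noncomputable def ind {P : Type*} (A : Set P) : P → ℝ :=
  A.indicator (fun _ => 1)

/-- The operation `J₁ * J₂` for the strict order `r`: the order ideal of `(P, r)` generated by
`(J₁ ∩ J₂) ∩ (max_r J₁ ∪ max_r J₂)`. -/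
def starOp {P : Type*} (r : P → P → Prop) (J₁ J₂ : Set P) : Set P :=
  {p | ∃ q ∈ (J₁ ∩ J₂) ∩ (maxSet r J₁ ∪ maxSet r J₂), p = q ∨ r p q}

/-- The admissible second orders `<'` (given as strict relations `r`) in the definition of the
marked relative poset polytopes of `(P, <)` with set of marked elements `M`. -/
structure IsAdmissibleOrder {P : Type*} [PartialOrder P] (M : Set P) (r : P → P → Prop) :
    Prop where
  strictOrder : IsStrictOrder P r
  weaker : ∀ p q, r p q → p < q
  star_closed : ∀ J₁ J₂ : LowerSet P, IsLowerSet (starOp r (J₁ : Set P) (J₂ : Set P))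
  marked_maximal : ∀ p ∈ M, ∀ q, ¬ r p q

/-- The set `M` of marked elements contains all minimal and all maximal elements. -/
def IsMarkedSet {P : Type*} [PartialOrder P] (M : Set P) : Prop :=
  ∀ p, IsMin p ∨ IsMax p → p ∈ M

/-- Dominant markings: `λ_p ≥ λ_q` for marked `p < q`. -/
def IsDominant {P : Type*} [PartialOrder P] {M : Set P} (lam : M → ℤ) : Prop :=
  ∀ p q : M, p < q → lam q ≤ lam p

/-! ### Decomposition of a marking into fundamental ones -/

/-- `α` is the family of coefficients of a decomposition `μ = ∑ α_K ω_K` over a chain of nonempty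
order ideals `K` of `Q` (in the application `Q` is the poset of marked elements). -/
structure IsMarkingDecomp {Q : Type*} [PartialOrder Q] (μ : Q → ℤ) (α : LowerSet Q → ℕ) :
    Prop where
  bot : α ⊥ = 0
  chain : ∀ K L, α K ≠ 0 → α L ≠ 0 → K ≤ L ∨ L ≤ K
  sum : ∀ p, (μ p : ℝ) = ∑ᶠ K : LowerSet Q, (α K : ℝ) * ind (K : Set Q) p

open Classical in
/-- The coefficient `α_K(μ)` in the decomposition of a nonnegative dominant marking `μ`
(the decomposition exists and is unique, see `existsUnique_markingDecomp`). -/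
noncomputable def markingCoeff {Q : Type*} [PartialOrder Q] (μ : Q → ℤ) : LowerSet Q → ℕ :=
  if h : ∃ α, IsMarkingDecomp μ α then h.choose else 0

open Classical in
theorem exists_markingDecomp {Q : Type*} [PartialOrder Q] [Finite Q] (μ : Q → ℤ)
    (h0 : ∀ p, 0 ≤ μ p) (hμ : ∀ p q, p < q → μ q ≤ μ p) :
    ∃ α, IsMarkingDecomp μ α := by
  have := Fintype.ofFinite Q
  have := Fintype.ofFinite (LowerSet Q)
  have hanti : ∀ p q, p ≤ q → μ q ≤ μ p := by
    intro p q h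
    rcases h.eq_or_lt with rfl | h
    · exact le_rfl
    · exact hμ _ _ h
  let lev : ℤ → LowerSet Q := fun m => ⟨{p | m ≤ μ p}, fun a b hab ha => le_trans ha (hanti _ _ hab)⟩
  have hlev : ∀ m p, p ∈ lev m ↔ m ≤ μ p := fun m p => Iff.rfl
  obtain ⟨B, hB⟩ : ∃ B : ℤ, ∀ p, μ p ≤ B :=
    ⟨∑ p, μ p, fun p => Finset.single_le_sum (fun i _ => h0 i) (Finset.mem_univ p)⟩
  have key : ∀ K : LowerSet Q, ((Finset.Icc 1 B).filter (fun m => lev m = K)).card ≠ 0 →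
      ∃ m, lev m = K := by
    intro K hK
    obtain ⟨m, hm⟩ := Finset.card_ne_zero.1 hK
    exact ⟨m, (Finset.mem_filter.1 hm).2⟩
  refine ⟨fun K => if K = ⊥ then 0 else ((Finset.Icc 1 B).filter (fun m => lev m = K)).card,
    by simp, ?_, ?_⟩
  · intro K L hK hL
    obtain ⟨m, rfl⟩ := key K (by split_ifs at hK with h; exacts [absurd rfl hK, hK])
    obtain ⟨k, rfl⟩ := key L (by split_ifs at hL with h; exacts [absurd rfl hL, hL])
    rcases le_total m k with h | h
    · exact Or.inr fun p hp => le_trans h hp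
    · exact Or.inl fun p hp => le_trans h hp
  · intro p
    rw [finsum_eq_sum_of_fintype]
    have h1 : ∀ K : LowerSet Q,
        (((if K = ⊥ then 0 else ((Finset.Icc 1 B).filter (fun m => lev m = K)).card : ℕ) : ℝ)
          * ind (K : Set Q) p) =
        ∑ m ∈ Finset.Icc 1 B, if lev m = K then (if m ≤ μ p then (1 : ℝ) else 0) else 0 := by
      intro K
      by_cases hp : p ∈ K
      · have hne : K ≠ ⊥ := by rintro rfl; exact hp
        have : ∀ m, (if lev m = K then (if m ≤ μ p then (1 : ℝ) else 0) else 0)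
            = if lev m = K then 1 else 0 := by
          intro m
          split_ifs with h h2
          · rfl
          · subst h; exact absurd hp h2
          · rfl
        simp [ind, hp, hne, this]
      · have : ∀ m, (if lev m = K then (if m ≤ μ p then (1 : ℝ) else 0) else 0) = 0 := by
          intro m
          split_ifs with h h2
          · subst h; exact absurd h2 hp
          · rfl
          · rfl
        simp [ind, hp, this]
    rw [Finset.sum_congr rfl (fun K _ => h1 K), Finset.sum_comm]
    simp only [Finset.sum_ite_eq, Finset.mem_univ, if_true]
    rw [Finset.sum_ite, Finset.sum_const_zero, add_zero, Finset.sum_const]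
    have : (Finset.Icc 1 B).filter (fun m => m ≤ μ p) = Finset.Icc 1 (μ p) := by
      ext m
      simp only [Finset.mem_filter, Finset.mem_Icc]
      have := hB p
      omega
    rw [this, Int.card_Icc]
    have := h0 p
    have h2 : ((μ p + 1 - 1).toNat : ℤ) = μ p := by omega
    simp only [nsmul_eq_mul, mul_one]
    exact_mod_cast h2.symm

open Classical in
theorem IsMarkingDecomp.unique {Q : Type*} [PartialOrder Q] [Finite Q] {μ : Q → ℤ}
    {α β : LowerSet Q → ℕ} (hα : IsMarkingDecomp μ α) (hβ : IsMarkingDecomp μ β) : α = β := by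
  have := Fintype.ofFinite Q
  have := Fintype.ofFinite (LowerSet Q)
  have sumN : ∀ {α : LowerSet Q → ℕ}, IsMarkingDecomp μ α → ∀ p,
      μ p = ((∑ K ∈ Finset.univ.filter (fun K : LowerSet Q => p ∈ K), α K : ℕ) : ℤ) := by
    intro α hα p
    have h := hα.sum p
    rw [finsum_eq_sum_of_fintype] at h
    have h1 : ∀ K : LowerSet Q, (α K : ℝ) * ind (K : Set Q) p = if p ∈ K then (α K : ℝ) else 0 := by
      intro K
      by_cases hp : p ∈ K <;> simp [ind, hp]
    rw [Finset.sum_congr rfl (fun K _ => h1 K), ← Finset.sum_filter] at h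
    exact_mod_cast h
  have lower : ∀ {α : LowerSet Q → ℕ}, IsMarkingDecomp μ α → ∀ K : LowerSet Q, ∀ p ∈ K,
      ((∑ L ∈ Finset.univ.filter (fun L : LowerSet Q => K ≤ L), α L : ℕ) : ℤ) ≤ μ p := by
    intro α hα K p hp
    rw [sumN hα p]
    exact_mod_cast Finset.sum_le_sum_of_subset
      (Finset.monotone_filter_right _ (fun L _ (hL : K ≤ L) => (hL : (K : Set Q) ⊆ L) hp))
  have attain : ∀ {α : LowerSet Q → ℕ}, IsMarkingDecomp μ α → ∀ K : LowerSet Q, K ≠ ⊥ →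
      ∃ p ∈ K, μ p =
        ((∑ L ∈ Finset.univ.filter (fun L : LowerSet Q => K ≤ L), α L : ℕ) : ℤ) := by
    intro α hα K hK
    obtain ⟨p, hpK, hp⟩ : ∃ p ∈ K, ∀ L, α L ≠ 0 → p ∈ L → K ≤ L := by
      let S := Finset.univ.filter (fun L : LowerSet Q => α L ≠ 0 ∧ ¬ K ≤ L)
      by_cases hS : S.Nonempty
      · obtain ⟨L₀, hL₀⟩ := S.exists_maximal hS
        obtain ⟨h1, h2⟩ := (Finset.mem_filter.1 hL₀.prop).2
        obtain ⟨p, hpK, hpL⟩ := Set.not_subset.1 (fun h : (K : Set Q) ⊆ L₀ => h2 h)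
        refine ⟨p, hpK, fun L hL hpL' => ?_⟩
        by_contra hKL
        have hLS : L ∈ S := Finset.mem_filter.2 ⟨Finset.mem_univ _, hL, hKL⟩
        rcases hα.chain L L₀ hL h1 with h | h
        · exact hpL (h hpL')
        · exact hpL (hL₀.le_of_ge hLS h hpL')
      · have hne : ∃ p, p ∈ K := by
          by_contra hcon
          push Not at hcon
          exact hK (le_bot_iff.1 fun p hp => absurd hp (hcon p))
        obtain ⟨p, hp⟩ := hne
        refine ⟨p, hp, fun L hL _ => ?_⟩
        by_contra hKL
        exact hS ⟨L, Finset.mem_filter.2 ⟨Finset.mem_univ _, hL, hKL⟩⟩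
    refine ⟨p, hpK, ?_⟩
    rw [sumN hα p]
    congr 1
    rw [Finset.sum_filter, Finset.sum_filter]
    refine Finset.sum_congr rfl fun L _ => ?_
    by_cases hL : α L = 0
    · simp [hL]
    · have : p ∈ L ↔ K ≤ L := ⟨fun h => hp L hL h, fun h => h hpK⟩
      simp [this]
  have tail : ∀ K : LowerSet Q, K ≠ ⊥ →
      ∑ L ∈ Finset.univ.filter (fun L : LowerSet Q => K ≤ L), α L =
        ∑ L ∈ Finset.univ.filter (fun L : LowerSet Q => K ≤ L), β L := by
    intro K hK
    obtain ⟨p, hp, h1⟩ := attain hα K hK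
    obtain ⟨q, hq, h2⟩ := attain hβ K hK
    have h3 := lower hβ K p hp
    have h4 := lower hα K q hq
    omega
  have split : ∀ (γ : LowerSet Q → ℕ) (K : LowerSet Q),
      ∑ L ∈ Finset.univ.filter (fun L : LowerSet Q => K ≤ L), γ L =
        γ K + ∑ L ∈ Finset.univ.filter (fun L : LowerSet Q => K < L), γ L := by
    intro γ K
    rw [← Finset.sum_insert (by simp)]
    congr 1
    ext L
    simp [le_iff_eq_or_lt, eq_comm]
  funext K
  induction K using WellFoundedGT.induction with
  | ind K ih =>
    by_cases hK : K = ⊥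
    · subst hK; rw [hα.bot, hβ.bot]
    · have h := tail K hK
      have h2 : ∑ L ∈ Finset.univ.filter (fun L : LowerSet Q => K < L), α L =
          ∑ L ∈ Finset.univ.filter (fun L : LowerSet Q => K < L), β L :=
        Finset.sum_congr rfl (fun L hL => ih L (Finset.mem_filter.1 hL).2)
      rw [split α K, split β K, h2] at h
      exact Nat.add_right_cancel h

theorem existsUnique_markingDecomp {Q : Type*} [PartialOrder Q] [Finite Q] (μ : Q → ℤ)
    (h0 : ∀ p, 0 ≤ μ p) (hμ : ∀ p q, p < q → μ q ≤ μ p) :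
    ∃! α, IsMarkingDecomp μ α := by
  obtain ⟨α, hα⟩ := exists_markingDecomp μ h0 hμ
  exact ⟨α, hα, fun β hβ => hβ.unique hα⟩

theorem isMarkingDecomp_markingCoeff {Q : Type*} [PartialOrder Q] [Finite Q] (μ : Q → ℤ)
    (h0 : ∀ p, 0 ≤ μ p) (hμ : ∀ p q, p < q → μ q ≤ μ p) :
    IsMarkingDecomp μ (markingCoeff μ) := by
  have h := exists_markingDecomp μ h0 hμ
  rw [markingCoeff, dif_pos h]
  exact h.choose_spec

/-! ### Marked relative poset polytopes -/

/-- The fundamental MRPP `R_{ω_K}(P, <, r)`: the convex hull of the points `1_{max_r J}` over the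
order ideals `J` of `(P, <)` with `J ∩ M = K`. -/
noncomputable def fundMRPP {P : Type*} [PartialOrder P] (M : Set P) (r : P → P → Prop)
    (K : LowerSet M) : Set (P → ℝ) :=
  convexHull ℝ {x | ∃ J : LowerSet P, (∀ p : M, (p : P) ∈ J ↔ p ∈ K) ∧
    x = ind (maxSet r (J : Set P))}

/-- The MRPP of a nonnegative dominant marking `μ`: the Minkowski sum `∑_K α_K(μ) R_{ω_K}`. -/
noncomputable def mrppNonneg {P : Type*} [PartialOrder P] (M : Set P) (r : P → P → Prop)
    (μ : M → ℤ) : Set (P → ℝ) :=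
  ∑ᶠ K : LowerSet M, (markingCoeff μ K : ℝ) • fundMRPP M r K

/-- `R_{λ + β ω_M}(P, <, r) - β 1_{max_r P}`, for an integer `β` such that `λ + β ω_M` is
nonnegative. -/
noncomputable def mrppShifted {P : Type*} [PartialOrder P] (M : Set P) (r : P → P → Prop)
    (lam : M → ℤ) (β : ℤ) : Set (P → ℝ) :=
  (fun x => x - (β : ℝ) • ind (maxSet r Set.univ)) '' mrppNonneg M r (fun p => lam p + β)

/-- A concrete `β ≥ 0` for which `λ + β ω_M` is nonnegative; it is `0` if `λ` is nonnegative. -/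
noncomputable def markingShift {P : Type*} {M : Set P} (lam : M → ℤ) : ℤ :=
  ∑ᶠ p : M, max 0 (-lam p)

/-- The marked relative poset polytope `R_λ(P, <, r)`. -/
noncomputable def mrpp {P : Type*} [PartialOrder P] (M : Set P) (r : P → P → Prop)
    (lam : M → ℤ) : Set (P → ℝ) :=
  mrppShifted M r lam (markingShift lam)

/-! ### Marked chain-order polytopes -/

/-- The marked chain-order polytope `O_{C,O}(P, <, λ)`. The chains `a < p₁ < ⋯ < p_r < b` include
those with `r = 0`. -/
def mcop {P : Type*} [PartialOrder P] (M C O : Set P) (lam : M → ℤ) : Set (P → ℝ) :=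
  {x | (∀ p : M, x p = lam p) ∧ (∀ p ∈ C, 0 ≤ x p) ∧
    ∀ a ∈ M ∪ O, ∀ b ∈ M ∪ O, ∀ c : List P, (∀ p ∈ c, p ∈ C) →
      List.IsChain (· < ·) (a :: (c ++ [b])) → (c.map x).sum ≤ x a - x b}

/-- The relation `p <' q` iff `p < q` and `p ∉ S`. -/
def removeBelow {P : Type*} [PartialOrder P] (S : Set P) (p q : P) : Prop :=
  p < q ∧ p ∉ S

/-! ### The Gelfand-Tsetlin poset of a flag type

A flag type is given by `d 0 < d 1 < ⋯ < d l` with `d 0 = 0` and `d l = n`; the element `p_{i,j}`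
is represented by the pair `(i, j)`, and the order is the componentwise one. -/

/-- The pair representing `p_{d_{k-1}+1, d_k}`, where `k` is counted from `0`. -/
def flagCorner {l : ℕ} (d : Fin (l + 1) → ℕ) (k : Fin l) : ℕ × ℕ :=
  (d k.castSucc + 1, d k.succ)

/-- The underlying set of the poset `P_d`: the pairs `p_{d_{k-1}+1, d_k}`, `1 ≤ k ≤ l`, together
with the pairs `p_{i,j}`, `1 ≤ i ≤ d_m < j ≤ n`, for `1 ≤ m ≤ l - 1`. -/
def flagPoset {l : ℕ} (d : Fin (l + 1) → ℕ) : Set (ℕ × ℕ) :=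
  {p | (∃ k : Fin l, p = flagCorner d k) ∨
    ∃ m : Fin (l + 1), m ≠ 0 ∧ m ≠ Fin.last l ∧
      1 ≤ p.1 ∧ p.1 ≤ d m ∧ d m + 1 ≤ p.2 ∧ p.2 ≤ d (Fin.last l)}

instance {l : ℕ} (d : Fin (l + 1) → ℕ) : Finite (flagPoset d) := by
  refine Set.Finite.subset ((Set.finite_range (flagCorner d)).union (Set.finite_iUnion fun m =>
    (Set.finite_Iic (d m)).prod (Set.finite_Iic (d (Fin.last l))))) ?_
  rintro p (⟨k, rfl⟩ | ⟨m, -, -, -, h1, -, h2⟩)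
  · exact Or.inl ⟨k, rfl⟩
  · exact Or.inr (Set.mem_iUnion.2 ⟨m, h1, h2⟩)

/-- The marked elements of `P_d`: the elements `p_{d_{k-1}+1, d_k}`, `1 ≤ k ≤ l`. -/
def flagMarked {l : ℕ} (d : Fin (l + 1) → ℕ) : Set (flagPoset d) :=
  {p | ∃ k : Fin l, (p : ℕ × ℕ) = flagCorner d k}

/-- The set `K_{i+1}` consisting of the first `i + 1` marked elements. -/
def flagIdeal {l : ℕ} (d : Fin (l + 1) → ℕ) (i : Fin l) : Set (flagMarked d) :=
  {p | ∃ k : Fin l, k ≤ i ∧ (p : ℕ × ℕ) = flagCorner d k}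

/-- The marking `λ = ω_{K_1} + ⋯ + ω_{K_l}` of `P_d`. -/
noncomputable def flagMarking {l : ℕ} (d : Fin (l + 1) → ℕ) (p : flagMarked d) : ℤ :=
  ∑ i : Fin l, (flagIdeal d i).indicator (fun _ => 1) p

/-! ### Gelfand-Tsetlin and FFLV polytopes of `gl_n`-weights -/

/-- The `i`-th coordinate (`1 ≤ i ≤ n`) of the fundamental `gl_n`-weight
`ω_k = (1, …, 1, 0, …, 0)` with `k` ones. -/
def fundWeight (k i : ℕ) : ℤ := if i ≤ k then 1 else 0

/-- The `gl_n`-weight `ω_{d_1} + ⋯ + ω_{d_{l-1}}`. -/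
def flagWeight {l : ℕ} (d : Fin (l + 1) → ℕ) (i : ℕ) : ℤ :=
  ∑ m : Fin (l + 1), if m ≠ 0 ∧ m ≠ Fin.last l then fundWeight (d m) i else 0

/-- The pairs `(i, j)` with `1 ≤ i ≤ j ≤ n`. -/
def Tri (n : ℕ) : Set (ℕ × ℕ) := {p | 1 ≤ p.1 ∧ p.1 ≤ p.2 ∧ p.2 ≤ n}

/-- The step relation: from `(i, j)` to `(i, j + 1)` or `(i + 1, j)`. -/
def TriStep {n : ℕ} (p q : Tri n) : Prop :=
  (q : ℕ × ℕ) = ((p : ℕ × ℕ).1, (p : ℕ × ℕ).2 + 1) ∨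
    (q : ℕ × ℕ) = ((p : ℕ × ℕ).1 + 1, (p : ℕ × ℕ).2)

/-- The Gelfand-Tsetlin polytope of the weight `μ`: triangular arrays with `z_{i,i} = μ_i` and
`z_{i,j} ≥ z_{i,j+1} ≥ z_{i+1,j+1}`. -/
def gtPolytope (n : ℕ) (μ : ℕ → ℤ) : Set (Tri n → ℝ) :=
  {z | (∀ p : Tri n, (p : ℕ × ℕ).1 = (p : ℕ × ℕ).2 → z p = μ (p : ℕ × ℕ).1) ∧
    ∀ p q : Tri n, TriStep p q → z q ≤ z p}

/-- The FFLV polytope of the weight `μ`. The coordinate `z_{i,j}` with `i < j` corresponds to the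
positive root `ε_i - ε_j`, the coordinates `z_{i,i} = μ_i` are constant; `c` runs over the Dyck
paths of positive roots starting in the simple root `ε_i - ε_{i+1}` and ending in the simple root
`ε_j - ε_{j+1}`. -/
def fflvPolytope (n : ℕ) (μ : ℕ → ℤ) : Set (Tri n → ℝ) :=
  {z | (∀ p : Tri n, (p : ℕ × ℕ).1 = (p : ℕ × ℕ).2 → z p = μ (p : ℕ × ℕ).1) ∧
    (∀ p : Tri n, (p : ℕ × ℕ).1 < (p : ℕ × ℕ).2 → 0 ≤ z p) ∧
    ∀ (i j : ℕ) (c : List (Tri n)),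
      (∀ p ∈ c, (p : ℕ × ℕ).1 < (p : ℕ × ℕ).2) →
      List.IsChain TriStep c →
      c.head?.map Subtype.val = some (i, i + 1) →
      c.getLast?.map Subtype.val = some (j, j + 1) →
      (c.map z).sum ≤ (μ i : ℝ) - μ (j + 1)}

open Classical in
/-- The array which agrees with `x` at the unmarked elements of `P_d` and with `c` at all other
pairs `(i, j)`. -/
noncomputable def flagExtend {l n : ℕ} (d : Fin (l + 1) → ℕ) (c : Tri n → ℝ)
    (x : flagPoset d → ℝ) : Tri n → ℝ :=
  fun t => if h : (t : ℕ × ℕ) ∈ flagPoset d then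
      (if (⟨t, h⟩ : flagPoset d) ∈ flagMarked d then c t else x ⟨t, h⟩)
    else c t

end PosetPolytope

/-! Put `S = M ∪ O`. Apart from fixing the marked coordinates, the inequalities of the chain-order
polytope are homogeneous and cut out a convex cone, `chainOrderCone S`. Each vertex `1_{max J}` lies
in this cone, and cones are stable under Minkowski sums and nonnegative scaling, so the relative
poset polytope is contained in the chain-order polytope.

The converse is a layer-cake argument. For `x` in the cone, invert the transfer map: `y = x` on `S`,
and `y p = x p + max_{q > p} y q` off `S`. The chain inequalities say that `y` is antitone, so each
`{y ≥ t}` is an order ideal, and `p` is `<'`-maximal in it exactly when `y p - x p < t ≤ y p`, an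
interval of length `x p`. Hence `x` is the integral of `1_{max {y ≥ t}}` over `0 < t ≤ B`. Cut at
the integers: since `μ` is integral, all ideals with `m < t ≤ m + 1` have the same marked part `{μ ≥
m + 1}`, so the slice is an average of vertices of one fundamental polytope. Grouping equal marked
parts gives the Minkowski sum (`subset_mrppNonneg`).

For the flag posets, a pair `(i, j)` that is not an unmarked element has both indices in one block
of `d`. There the weight is constant and the GT or FFLV inequalities force the coordinate. On the
remaining pairs, GT means antitone along unit steps; for FFLV, nonnegativity allows every chain to
be completed to a Dyck path. -/

namespace PosetPolytope

/-! ### Admissibility, the cone, and the decomposition of markings -/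

section General

theorem ind_apply_of_mem {P : Type*} {A : Set P} {p : P} (h : p ∈ A) : ind A p = 1 :=
  Set.indicator_of_mem h _

theorem ind_apply_of_notMem {P : Type*} {A : Set P} {p : P} (h : p ∉ A) : ind A p = 0 :=
  Set.indicator_of_notMem h _

theorem ind_nonneg {P : Type*} (A : Set P) (p : P) : 0 ≤ ind A p :=
  Set.indicator_nonneg (fun _ _ => zero_le_one) p

variable {P : Type*} [PartialOrder P]

/-- An element of `S` is `<'`-below nothing, so it is `<'`-maximal in every ideal containing it.
Thus an element strictly below a generator either lies in `S` and is itself a generator, or lies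
outside `S` and is `<'`-below that generator. -/
theorem isAdmissibleOrder_removeBelow {M S : Set P} (hMS : M ⊆ S) :
    IsAdmissibleOrder M (removeBelow S) where
  strictOrder :=
    { irrefl := fun _ h => lt_irrefl _ h.1
      trans := fun _ _ _ h₁ h₂ => ⟨h₁.1.trans h₂.1, h₁.2⟩ }
  weaker := fun _ _ h => h.1
  star_closed := by
    rintro J₁ J₂ p p' hle ⟨q, ⟨⟨hq₁, hq₂⟩, hq⟩, hpq⟩
    have hpq' : p ≤ q := hpq.elim (fun h => h.le) fun h => h.1.le
    rcases (hle.trans hpq').eq_or_lt with h | h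
    · exact ⟨q, ⟨⟨hq₁, hq₂⟩, hq⟩, Or.inl h⟩
    by_cases hS : p' ∈ S
    · have h₁ : p' ∈ (J₁ : Set P) := J₁.lower h.le hq₁
      have h₂ : p' ∈ (J₂ : Set P) := J₂.lower h.le hq₂
      exact ⟨p', ⟨⟨h₁, h₂⟩, Or.inl ⟨h₁, fun _ _ hr => hr.2 hS⟩⟩, Or.inl rfl⟩
    · exact ⟨q, ⟨⟨hq₁, hq₂⟩, hq⟩, Or.inr ⟨h, hS⟩⟩
  marked_maximal := fun _ hp _ hr => hr.2 (hMS hp)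

theorem IsMarkedSet.exists_ge [Finite P] {M : Set P} (hM : IsMarkedSet M) (p : P) :
    ∃ q ∈ M, p ≤ q := by
  obtain ⟨q, hpq, hq⟩ := Finite.exists_le_maximal (p := fun _ : P => True) (a := p) trivial
  exact ⟨q, hM q (Or.inr fun r hr => hq.2 trivial hr), hpq⟩

theorem IsMarkedSet.exists_le [Finite P] {M : Set P} (hM : IsMarkedSet M) (p : P) :
    ∃ q ∈ M, q ≤ p := by
  obtain ⟨q, hpq, hq⟩ := Finite.exists_le_minimal (p := fun _ : P => True) (a := p) trivial
  exact ⟨q, hM q (Or.inl fun r hr => hq.2 trivial hr), hpq⟩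

theorem IsMarkedSet.exists_gt [Finite P] {M : Set P} (hM : IsMarkedSet M) {p : P} (hp : p ∉ M) :
    ∃ q, p < q := by
  obtain ⟨q, hq, hpq⟩ := hM.exists_ge p
  exact ⟨q, hpq.lt_of_ne fun h => hp (h ▸ hq)⟩

/-- The cone cut out by the inequalities of a marked chain-order polytope which do not involve the
marking; `S` is the set of elements which are marked or of order type. -/
def chainOrderCone (S : Set P) : PointedCone ℝ (P → ℝ) where
  carrier := {x | (∀ p ∉ S, 0 ≤ x p) ∧ ∀ a ∈ S, ∀ b ∈ S, ∀ c : List P, (∀ p ∈ c, p ∉ S) →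
      List.IsChain (· < ·) (a :: (c ++ [b])) → (c.map x).sum ≤ x a - x b}
  zero_mem' := ⟨fun _ _ => le_rfl, fun a _ b _ c _ _ => by simp [Pi.zero_def]⟩
  add_mem' := by
    rintro x y ⟨hx, hx'⟩ ⟨hy, hy'⟩
    refine ⟨fun p hp => add_nonneg (hx p hp) (hy p hp), fun a ha b hb c hc h => ?_⟩
    have h₁ := hx' a ha b hb c hc h
    have h₂ := hy' a ha b hb c hc h
    have h₃ : (c.map (x + y)).sum = (c.map x).sum + (c.map y).sum := List.sum_map_add
    simp only [h₃, Pi.add_apply]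
    linarith
  smul_mem' := by
    rintro ⟨t, ht⟩ x ⟨hx, hx'⟩
    refine ⟨fun p hp => mul_nonneg ht (hx p hp), fun a ha b hb c hc h => ?_⟩
    have h₁ := mul_le_mul_of_nonneg_left (hx' a ha b hb c hc h) ht
    have h₃ : (c.map (fun p => t * x p)).sum = t * (c.map x).sum := List.sum_map_mul_left ..
    change (c.map (fun p => t * x p)).sum ≤ t * x a - t * x b
    rw [h₃]
    linarith

theorem mem_chainOrderCone {S : Set P} {x : P → ℝ} :
    x ∈ chainOrderCone S ↔ (∀ p ∉ S, 0 ≤ x p) ∧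
      ∀ a ∈ S, ∀ b ∈ S, ∀ c : List P, (∀ p ∈ c, p ∉ S) →
        List.IsChain (· < ·) (a :: (c ++ [b])) → (c.map x).sum ≤ x a - x b :=
  Iff.rfl

theorem mem_mcop_iff {M C O : Set P} (hCO : Disjoint C O) (hM : C ∪ O = Mᶜ) {lam : M → ℤ}
    {x : P → ℝ} :
    x ∈ mcop M C O lam ↔ (∀ p : M, x p = lam p) ∧ x ∈ chainOrderCone (M ∪ O) := by
  have hC : ∀ p, p ∈ C ↔ p ∉ M ∪ O := by
    intro p
    have h := Set.ext_iff.1 hM p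
    have h' : p ∈ C → p ∉ O := fun h₁ h₂ => Set.disjoint_left.1 hCO h₁ h₂
    simp only [Set.mem_union, Set.mem_compl_iff] at h ⊢
    tauto
  simp only [mcop, Set.mem_ofPred_eq, mem_chainOrderCone, hC]

/-- Each `x p` is bounded by the drop of `y` to the next element of the chain, and the drops
telescope. -/
theorem sum_map_le_of_isChain {x y : P → ℝ} {S : Set P}
    (hxy : ∀ p ∉ S, ∀ q, p < q → x p ≤ y p - y q) (b : P) :
    ∀ (c : List P) (p : P), p ∉ S → (∀ q ∈ c, q ∉ S) →
      List.IsChain (· < ·) (p :: (c ++ [b])) → ((p :: c).map x).sum ≤ y p - y b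
  | [], p, hp, _, h => by simpa using hxy p hp b (by simpa using h)
  | q :: c, p, hp, hc, h => by
    rw [List.cons_append, List.isChain_cons_cons] at h
    have h₁ := sum_map_le_of_isChain hxy b c q (hc q (by simp))
      (fun r hr => hc r (by simp [hr])) h.2
    have h₂ := hxy p hp q h.1
    rw [List.map_cons, List.sum_cons]
    linarith

theorem mem_chainOrderCone_of_antitone {x y : P → ℝ} {S : Set P} (hy : Antitone y)
    (hx : ∀ p ∉ S, 0 ≤ x p) (hS : ∀ p ∈ S, x p = y p)
    (hxy : ∀ p ∉ S, ∀ q, p < q → x p ≤ y p - y q) : x ∈ chainOrderCone S := by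
  refine mem_chainOrderCone.2 ⟨hx, fun a ha b hb c hc h => ?_⟩
  rw [hS a ha, hS b hb]
  cases c with
  | nil => simpa using hy (le_of_lt (by simpa using h : a < b))
  | cons p c =>
    rw [List.cons_append, List.isChain_cons_cons] at h
    have h₁ := sum_map_le_of_isChain hxy b c p (hc p (by simp))
      (fun r hr => hc r (by simp [hr])) h.2
    have h₂ := hy h.1.le
    linarith

theorem mem_maxSet_removeBelow {S J : Set P} {p : P} :
    p ∈ maxSet (removeBelow S) J ↔ p ∈ J ∧ (p ∈ S ∨ ∀ q, p < q → q ∉ J) := by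
  simp only [maxSet, removeBelow, Set.mem_ofPred_eq]
  constructor
  · rintro ⟨h, h'⟩
    refine ⟨h, or_iff_not_imp_left.2 fun hS q hq hJ => h' q hJ ⟨hq, hS⟩⟩
  · rintro ⟨h, h'⟩
    refine ⟨h, fun q hJ hq => ?_⟩
    rcases h' with h' | h'
    exacts [hq.2 h', h' q hq.1 hJ]

/-- Take `y = 1_J` as the potential: off `S`, a maximal `p` has everything above it outside `J`, so
the drop of `y` from `p` is 1. -/
theorem ind_maxSet_mem_chainOrderCone (S : Set P) (J : LowerSet P) :
    ind (maxSet (removeBelow S) (J : Set P)) ∈ chainOrderCone S := by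
  refine mem_chainOrderCone_of_antitone (y := ind (J : Set P)) ?_ (fun p _ => ind_nonneg _ p) ?_ ?_
  · intro p q hpq
    by_cases hq : q ∈ (J : Set P)
    · rw [ind_apply_of_mem hq, ind_apply_of_mem (J.lower hpq hq)]
    · rw [ind_apply_of_notMem hq]
      exact ind_nonneg _ p
  · intro p hp
    by_cases h : p ∈ (J : Set P)
    · rw [ind_apply_of_mem h, ind_apply_of_mem (mem_maxSet_removeBelow.2 ⟨h, Or.inl hp⟩)]
    · rw [ind_apply_of_notMem h, ind_apply_of_notMem fun h' => h h'.1]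
  · intro p hp q hpq
    by_cases h : p ∈ maxSet (removeBelow S) (J : Set P)
    · have h' := mem_maxSet_removeBelow.1 h
      rw [ind_apply_of_mem h, ind_apply_of_mem h'.1,
        ind_apply_of_notMem (h'.2.resolve_left hp q hpq), sub_zero]
    · rw [ind_apply_of_notMem h]
      by_cases hq : q ∈ (J : Set P)
      · rw [ind_apply_of_mem hq, ind_apply_of_mem (J.lower hpq.le hq), sub_self]
      · rw [ind_apply_of_notMem hq, sub_zero]
        exact ind_nonneg _ p

theorem fundMRPP_subset {M S : Set P} (hMS : M ⊆ S) (K : LowerSet M) {x : P → ℝ}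
    (hx : x ∈ fundMRPP M (removeBelow S) K) :
    (∀ p : M, x p = ind (K : Set M) p) ∧ x ∈ chainOrderCone S := by
  have h₁ : Convex ℝ {x : P → ℝ | ∀ p : M, x p = ind (K : Set M) p} := by
    intro x hx y hy a b _ _ hab p
    have hx := hx p
    have hy := hy p
    simp only [Pi.add_apply, Pi.smul_apply, smul_eq_mul, hx, hy, ← add_mul, hab, one_mul]
  refine convexHull_min ?_ (h₁.inter (chainOrderCone S).convex) hx
  rintro _ ⟨J, hJ, rfl⟩
  refine ⟨fun p => ?_, ind_maxSet_mem_chainOrderCone S J⟩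
  by_cases h : p ∈ K
  · rw [ind_apply_of_mem (A := (K : Set M)) h, ind_apply_of_mem]
    exact mem_maxSet_removeBelow.2 ⟨(hJ p).2 h, Or.inl (hMS p.2)⟩
  · rw [ind_apply_of_notMem (A := (K : Set M)) h, ind_apply_of_notMem]
    exact fun h' => h ((hJ p).1 h'.1)

theorem mrppNonneg_subset [Finite P] {M S : Set P} (hMS : M ⊆ S) {μ : M → ℤ} (h0 : ∀ p, 0 ≤ μ p)
    (hμ : IsDominant μ) {x : P → ℝ} (hx : x ∈ mrppNonneg M (removeBelow S) μ) :
    (∀ p : M, x p = μ p) ∧ x ∈ chainOrderCone S := by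
  have := Fintype.ofFinite (LowerSet M)
  rw [mrppNonneg, finsum_eq_sum_of_fintype, Set.mem_finsetSum] at hx
  obtain ⟨g, hg, rfl⟩ := hx
  have h : ∀ K, ∃ v ∈ fundMRPP M (removeBelow S) K, (markingCoeff μ K : ℝ) • v = g K :=
    fun K => Set.mem_smul_set.1 (hg (Finset.mem_univ K))
  choose v hv hvg using h
  refine ⟨fun p => ?_, Submodule.sum_mem _ fun K _ => ?_⟩
  · rw [(isMarkingDecomp_markingCoeff μ h0 hμ).sum p, finsum_eq_sum_of_fintype, Finset.sum_apply]
    refine Finset.sum_congr rfl fun K _ => ?_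
    rw [← hvg K, Pi.smul_apply, (fundMRPP_subset hMS K (hv K)).1 p, smul_eq_mul]
  · rw [← hvg K]
    exact (chainOrderCone S).smul_mem (Nat.cast_nonneg _)
      (fundMRPP_subset hMS K (hv K)).2

/-- The superlevel sets of an antitone marking as order ideals. -/
def superlevel {Q : Type*} [PartialOrder Q] {μ : Q → ℤ} (hμ : Antitone μ) (m : ℤ) : LowerSet Q :=
  ⟨{p | m ≤ μ p}, fun _ _ hab ha => le_trans ha (hμ hab)⟩

theorem mem_superlevel {Q : Type*} [PartialOrder Q] {μ : Q → ℤ} (hμ : Antitone μ) {m : ℤ} {p : Q} :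
    p ∈ superlevel hμ m ↔ m ≤ μ p :=
  Iff.rfl

open Classical in
-- The superlevel sets at heights `1, …, B` form a chain whose indicators add up to `μ`, so
-- uniqueness identifies the coefficients. Heights above all values of `μ` give the empty ideal,
-- which is discarded.
theorem markingCoeff_eq_card {Q : Type*} [PartialOrder Q] [Finite Q] {μ : Q → ℤ}
    (h0 : ∀ p, 0 ≤ μ p) (hμ : Antitone μ) {B : ℕ} (hB : ∀ p, μ p ≤ B) (K : LowerSet Q) :
    markingCoeff μ K = if K = ⊥ then 0 else
      ((Finset.range B).filter (fun m : ℕ => superlevel hμ (m + 1) = K)).card := by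
  have := Fintype.ofFinite (LowerSet Q)
  refine congrFun (IsMarkingDecomp.unique (β := fun K => if K = ⊥ then 0 else
      ((Finset.range B).filter (fun m : ℕ => superlevel hμ (m + 1) = K)).card)
    (isMarkingDecomp_markingCoeff μ h0 fun p q h => hμ h.le) ⟨if_pos rfl, ?_, ?_⟩) K
  · have key : ∀ K : LowerSet Q, (if K = ⊥ then 0 else
        ((Finset.range B).filter (fun m : ℕ => superlevel hμ (m + 1) = K)).card) ≠ 0 →
        ∃ m : ℕ, superlevel hμ (m + 1) = K := by
      intro K hK
      split_ifs at hK
      · exact absurd rfl hK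
      · obtain ⟨m, hm⟩ := Finset.card_ne_zero.1 hK
        exact ⟨m, (Finset.mem_filter.1 hm).2⟩
    intro K L hK hL
    obtain ⟨m, rfl⟩ := key K hK
    obtain ⟨k, rfl⟩ := key L hL
    rcases le_total m k with h | h
    · exact Or.inr fun p hp => le_trans (by exact_mod_cast Nat.succ_le_succ h)
        ((mem_superlevel hμ).1 hp)
    · exact Or.inl fun p hp => le_trans (by exact_mod_cast Nat.succ_le_succ h)
        ((mem_superlevel hμ).1 hp)
  · intro p
    rw [finsum_eq_sum_of_fintype]
    have h₁ : ∀ K : LowerSet Q,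
        (((if K = ⊥ then 0 else
          ((Finset.range B).filter (fun m : ℕ => superlevel hμ (m + 1) = K)).card : ℕ) : ℝ)
          * ind (K : Set Q) p) =
        ∑ m ∈ Finset.range B,
          if superlevel hμ (m + 1) = K then (if (m : ℤ) + 1 ≤ μ p then (1 : ℝ) else 0) else 0 := by
      intro K
      by_cases hp : p ∈ K
      · have hne : K ≠ ⊥ := by rintro rfl; exact hp
        rw [ind_apply_of_mem (A := (K : Set Q)) hp, mul_one, if_neg hne, Finset.card_filter,
          Nat.cast_sum]
        refine Finset.sum_congr rfl fun m _ => ?_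
        split_ifs with h h2
        · simp
        · exact absurd ((mem_superlevel hμ).1 (h ▸ hp)) h2
        · simp
      · rw [ind_apply_of_notMem (A := (K : Set Q)) hp, mul_zero]
        refine (Finset.sum_eq_zero fun m _ => ?_).symm
        split_ifs with h h2
        · exact absurd (h ▸ (mem_superlevel hμ).2 h2) hp
        · rfl
        · rfl
    rw [Finset.sum_congr rfl (fun K _ => h₁ K), Finset.sum_comm]
    simp only [Finset.sum_ite_eq, Finset.mem_univ, if_true]
    rw [Finset.sum_boole]
    have h₂ : (Finset.range B).filter (fun m : ℕ => (m : ℤ) + 1 ≤ μ p)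
        = Finset.range (μ p).toNat := by
      ext m
      simp only [Finset.mem_filter, Finset.mem_range]
      have := hB p
      have := h0 p
      omega
    rw [h₂, Finset.card_range]
    exact_mod_cast (Int.toNat_of_nonneg (h0 p)).symm

/-- Needed for the terms with coefficient 0: the dilate by 0 is `{0}` only for a nonempty set. -/
theorem fundMRPP_nonempty (M : Set P) (r : P → P → Prop) (K : LowerSet M) :
    (fundMRPP M r K).Nonempty := by
  refine ⟨_, subset_convexHull ℝ _ ⟨lowerClosure ((↑) '' (K : Set M)), fun p => ?_, rfl⟩⟩
  simp only [mem_lowerClosure, Set.mem_image]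
  constructor
  · rintro ⟨_, ⟨q, hq, rfl⟩, h⟩
    exact K.lower h hq
  · exact fun h => ⟨p, ⟨p, h, rfl⟩, le_rfl⟩

/-- Minimal elements are marked, so an ideal without marked elements is empty. Layers above the top
value of `μ` therefore contribute nothing. -/
theorem eq_zero_of_mem_fundMRPP_bot [Finite P] {M : Set P} (hM : IsMarkedSet M)
    {r : P → P → Prop} {x : P → ℝ} (hx : x ∈ fundMRPP M r ⊥) : x = 0 := by
  refine convexHull_min ?_ (convex_singleton (0 : P → ℝ)) hx
  rintro _ ⟨J, hJ, rfl⟩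
  refine funext fun p => ind_apply_of_notMem fun hp => ?_
  obtain ⟨q, hq, hqp⟩ := hM.exists_le p
  exact (hJ ⟨q, hq⟩).1 (J.lower hqp hp.1)

open Classical in
-- By convexity, a sum of `α_K` points of the polytope of `K` is `α_K` times their mean, hence a
-- point of its dilate.
theorem sum_mem_mrppNonneg [Finite P] {M : Set P} (hM : IsMarkedSet M) {r : P → P → Prop}
    {μ : M → ℤ} (h0 : ∀ p, 0 ≤ μ p) (hμ : Antitone μ) {B : ℕ} (hB : ∀ p, μ p ≤ B)
    {v : ℕ → P → ℝ} (hv : ∀ m < B, v m ∈ fundMRPP M r (superlevel hμ (m + 1))) :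
    ∑ m ∈ Finset.range B, v m ∈ mrppNonneg M r μ := by
  have := Fintype.ofFinite (LowerSet M)
  rw [mrppNonneg, finsum_eq_sum_of_fintype,
    ← Finset.sum_fiberwise (Finset.range B) (fun m : ℕ => superlevel hμ (m + 1)) v]
  refine Set.finsetSum_mem_finsetSum _ _ _ fun K _ => ?_
  set s := (Finset.range B).filter (fun m : ℕ => superlevel hμ (m + 1) = K) with hs
  have hvs : ∀ m ∈ s, v m ∈ fundMRPP M r K := by
    intro m hm
    obtain ⟨h₁, h₂⟩ := Finset.mem_filter.1 hm
    exact h₂ ▸ hv m (Finset.mem_range.1 h₁)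
  rw [markingCoeff_eq_card h0 hμ hB K]
  by_cases hK : K = ⊥
  · subst hK
    rw [if_pos rfl, Nat.cast_zero, Set.zero_smul_set (fundMRPP_nonempty M r _),
      Finset.sum_eq_zero fun m hm => eq_zero_of_mem_fundMRPP_bot hM (hvs m hm)]
    rfl
  rw [if_neg hK, ← hs]
  rcases s.eq_empty_or_nonempty with he | hne
  · rw [he, Finset.sum_empty, Finset.card_empty, Nat.cast_zero,
      Set.zero_smul_set (fundMRPP_nonempty M r _)]
    rfl
  · have hc : (s.card : ℝ) ≠ 0 := Nat.cast_ne_zero.2 (Finset.card_pos.2 hne).ne'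
    refine ⟨∑ m ∈ s, (s.card : ℝ)⁻¹ • v m,
      (convex_convexHull ℝ _).sum_mem (fun _ _ => by positivity) ?_ hvs, ?_⟩
    · rw [Finset.sum_const, nsmul_eq_mul, mul_inv_cancel₀ hc]
    · simp only [← Finset.smul_sum]
      rw [smul_inv_smul₀ hc]

end General

/-! ### The inverse transfer map and the layer-cake integral -/

section Transfer

theorem add_markingShift_nonneg {P : Type*} [Finite P] {M : Set P} (lam : M → ℤ) (p : M) :
    0 ≤ lam p + markingShift lam := by
  have := Fintype.ofFinite M
  rw [markingShift, finsum_eq_sum_of_fintype]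
  have h := Finset.single_le_sum (f := fun p => max 0 (-lam p)) (fun i _ => le_max_left _ _)
    (Finset.mem_univ p)
  have h' := le_max_right 0 (-lam p)
  linarith

variable {P : Type*} [PartialOrder P]

/-- The inverse of the transfer map: every `x` arises from some `y` with `x = y` on `S` and
`x p = y p - max_{q > p} y q` for `p ∉ S`. -/
theorem exists_inverse_transfer [Finite P] {S : Set P} (hS : ∀ p ∉ S, ∃ q, p < q) (x : P → ℝ) :
    ∃ y : P → ℝ, (∀ p ∈ S, y p = x p) ∧
      ∀ p ∉ S, (∀ q, p < q → x p + y q ≤ y p) ∧ ∃ q, p < q ∧ y p = x p + y q := by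
  classical
  -- Recursion downwards from the maximal elements: `y p` depends on the values strictly above `p`.
  have hwf : WellFounded (fun p q : P => q < p) := wellFounded_gt
  let F : (p : P) → ((q : P) → p < q → ℝ) → ℝ := fun p f =>
    if p ∈ S then x p else x p + ⨆ q : {q // p < q}, f q q.2
  refine ⟨hwf.fix F, fun p hp => ?_, fun p hp => ?_⟩
  · rw [hwf.fix_eq]
    exact if_pos hp
  · have h : hwf.fix F p = x p + ⨆ q : {q // p < q}, hwf.fix F q := by
      rw [hwf.fix_eq]
      exact if_neg hp
    obtain ⟨q, hq⟩ := hS p hp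
    have : Nonempty {q // p < q} := ⟨⟨q, hq⟩⟩
    refine ⟨fun q hq => ?_, ?_⟩
    · rw [h]
      gcongr
      exact le_ciSup (f := fun q : {q // p < q} => hwf.fix F q) (Set.finite_range _).bddAbove
        ⟨q, hq⟩
    · obtain ⟨q, hq⟩ := exists_eq_ciSup_of_finite (f := fun q : {q // p < q} => hwf.fix F q)
      exact ⟨q, q.2, by rw [h, hq]⟩

/-- Follow the elements where the maximum is attained upwards until `S` is reached. The chain is
stated with a free lower end `a < p`, ready for a cone inequality starting at `a`. -/
theorem exists_chain_of_inverse_transfer [Finite P] {S : Set P} {x y : P → ℝ}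
    (hyS : ∀ p ∈ S, y p = x p) (hy : ∀ p ∉ S, ∃ q, p < q ∧ y p = x p + y q) (p : P) :
    ∃ b ∈ S, ∃ c : List P, (∀ q ∈ c, q ∉ S) ∧
      (∀ a, a < p → List.IsChain (· < ·) (a :: (c ++ [b]))) ∧ y p = (c.map x).sum + x b := by
  induction p using WellFoundedGT.induction with
  | ind p ih =>
    by_cases hp : p ∈ S
    · exact ⟨p, hp, [], by simp, fun a ha => by simpa using ha, by simp [hyS p hp]⟩
    · obtain ⟨q, hpq, hq⟩ := hy p hp
      obtain ⟨b, hb, c, hc, hch, hsum⟩ := ih q hpq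
      refine ⟨b, hb, p :: c, ?_, fun a ha => ?_, ?_⟩
      · rintro r hr
        rcases List.mem_cons.1 hr with rfl | hr
        exacts [hp, hc r hr]
      · exact List.isChain_cons_cons.2 ⟨ha, hch p hpq⟩
      · rw [hq, hsum, List.map_cons, List.sum_cons, add_assoc]

/-- For `p ∉ S` antitonicity follows from `x p ≥ 0`. For `p ∈ S` below `q` it is the cone inequality
for the chain that computes `y q`. -/
theorem exists_antitone_of_mem_chainOrderCone [Finite P] {S : Set P} (hS : ∀ p ∉ S, ∃ q, p < q)
    {x : P → ℝ} (hx : x ∈ chainOrderCone S) :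
    ∃ y : P → ℝ, Antitone y ∧ (∀ p ∈ S, y p = x p) ∧
      ∀ p ∉ S, (∀ q, p < q → y q ≤ y p - x p) ∧ ∃ q, p < q ∧ y q = y p - x p := by
  obtain ⟨hx₀, hx₁⟩ := mem_chainOrderCone.1 hx
  obtain ⟨y, hyS, hy⟩ := exists_inverse_transfer hS x
  refine ⟨y, fun p q hpq => ?_, hyS, fun p hp => ⟨fun q hq => ?_, ?_⟩⟩
  · rcases hpq.eq_or_lt with rfl | hpq
    · exact le_rfl
    by_cases hp : p ∈ S
    · obtain ⟨b, hb, c, hc, hch, hsum⟩ :=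
        exists_chain_of_inverse_transfer hyS (fun p hp => (hy p hp).2) q
      have := hx₁ p hp b hb c hc (hch p hpq)
      rw [hsum, hyS p hp]
      linarith
    · have := (hy p hp).1 q hpq
      have := hx₀ p hp
      linarith
  · have := (hy p hp).1 q hq
    linarith
  · obtain ⟨q, hq, h⟩ := (hy p hp).2
    exact ⟨q, hq, by linarith⟩

/-- Off `S`, the number `y p - x p` is the maximum of `y` above `p`, so `t` exceeds it iff nothing
above `p` survives. On `S` it is 0, which is why `t` must be positive. -/
theorem ind_maxSet_superlevel {S : Set P} {x y : P → ℝ} (hyS : ∀ p ∈ S, y p = x p)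
    (hy : ∀ p ∉ S, (∀ q, p < q → y q ≤ y p - x p) ∧ ∃ q, p < q ∧ y q = y p - x p)
    {t : ℝ} (ht : 0 < t) (p : P) :
    ind (maxSet (removeBelow S) {p | t ≤ y p}) p =
      (Set.Ioc (y p - x p) (y p)).indicator (fun _ => 1) t := by
  have h : p ∈ maxSet (removeBelow S) {p | t ≤ y p} ↔ t ∈ Set.Ioc (y p - x p) (y p) := by
    rw [mem_maxSet_removeBelow, Set.mem_Ioc, Set.mem_ofPred_eq, and_comm]
    refine and_congr_left fun _ => ?_
    by_cases hp : p ∈ S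
    · simp [hp, hyS p hp, ht]
    · simp only [hp, false_or, Set.mem_ofPred_eq, not_le]
      obtain ⟨h₁, q, hpq, hq⟩ := hy p hp
      exact ⟨fun h => hq ▸ h q hpq, fun h q hpq => (h₁ q hpq).trans_lt h⟩
  by_cases hp : p ∈ maxSet (removeBelow S) {p | t ≤ y p}
  · rw [ind_apply_of_mem hp, Set.indicator_of_mem (h.1 hp)]
  · rw [ind_apply_of_notMem hp, Set.indicator_of_notMem fun h' => hp (h.2 h')]

open MeasureTheory in
theorem subset_mrppNonneg [Finite P] {M S : Set P} (hM : IsMarkedSet M) (hMS : M ⊆ S) {μ : M → ℤ}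
    (h0 : ∀ p, 0 ≤ μ p) (hμ : IsDominant μ) {x : P → ℝ} (hxM : ∀ p : M, x p = μ p)
    (hx : x ∈ chainOrderCone S) : x ∈ mrppNonneg M (removeBelow S) μ := by
  have := Fintype.ofFinite P
  have hanti : Antitone μ := by
    intro p q h
    rcases h.eq_or_lt with rfl | h
    exacts [le_rfl, hμ _ _ h]
  obtain ⟨y, hyanti, hyS, hy⟩ := exists_antitone_of_mem_chainOrderCone
    (fun p hp => hM.exists_gt fun h => hp (hMS h)) hx
  have hyM : ∀ p : M, y p = μ p := fun p => (hyS p (hMS p.2)).trans (hxM p)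
  obtain ⟨B, hB⟩ : ∃ B : ℕ, ∀ p, μ p ≤ B := by
    obtain ⟨b, hb⟩ := (Set.finite_range μ).bddAbove
    exact ⟨b.toNat, fun p => (hb ⟨p, rfl⟩).trans (Int.self_le_toNat b)⟩
  have hy0 : ∀ p, 0 ≤ y p := by
    intro p
    obtain ⟨q, hq, hpq⟩ := hM.exists_ge p
    refine le_trans ?_ (hyanti hpq)
    rw [hyM ⟨q, hq⟩]
    exact_mod_cast h0 ⟨q, hq⟩
  have hyB : ∀ p, y p ≤ B := by
    intro p
    obtain ⟨q, hq, hpq⟩ := hM.exists_le p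
    refine (hyanti hpq).trans ?_
    rw [hyM ⟨q, hq⟩]
    exact_mod_cast hB ⟨q, hq⟩
  have hz0 : ∀ p, 0 ≤ y p - x p := by
    intro p
    by_cases hp : p ∈ S
    · rw [hyS p hp, sub_self]
    · obtain ⟨q, _, hq⟩ := (hy p hp).2
      exact hq ▸ hy0 q
  have hx0 : ∀ p, 0 ≤ x p := by
    intro p
    by_cases hp : p ∈ S
    exacts [hyS p hp ▸ hy0 p, (mem_chainOrderCone.1 hx).1 p hp]
  let f : ℝ → P → ℝ := fun t p => (Set.Ioc (y p - x p) (y p)).indicator (fun _ => 1) t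
  have hfp : ∀ (p : P) (s : Set ℝ), volume s ≠ ⊤ →
      IntegrableOn (fun t => f t p) s := fun p s hs =>
    (integrableOn_const hs).indicator measurableSet_Ioc
  have hf : ∀ a b : ℝ, IntervalIntegrable f volume a b := by
    intro a b
    rw [intervalIntegrable_iff]
    exact Integrable.of_eval fun p => hfp p _ (by simp [Set.uIoc])
  -- Coordinatewise this is the length of `(y p - x p, y p]`, which lies in `(0, B]` and has length
  -- `x p`.
  have hsum : x = ∑ m ∈ Finset.range B, ∫ t in (m : ℝ)..((m + 1 : ℕ) : ℝ), f t := by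
    rw [intervalIntegral.sum_integral_adjacent_intervals (fun _ _ => hf _ _)]
    funext p
    rw [intervalIntegral.integral_of_le (by simp), eval_integral fun p => hfp p _ (by simp)]
    simp only [f]
    rw [setIntegral_indicator measurableSet_Ioc,
      Set.inter_eq_right.2 (Set.Ioc_subset_Ioc (by simpa using hz0 p) (hyB p))]
    simp [hx0 p]
  rw [hsum]
  refine sum_mem_mrppNonneg hM h0 hanti hB fun m _ => ?_
  rw [intervalIntegral.integral_of_le (by simp)]
  -- The slice has length 1, so its integral is an average; it stays in the hull because the hull of
  -- finitely many points is closed.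
  have hprob : IsProbabilityMeasure (volume.restrict (Set.Ioc (m : ℝ) ((m + 1 : ℕ) : ℝ))) :=
    ⟨by simp⟩
  have hfin : {x : P → ℝ | ∃ J : LowerSet P,
      (∀ p : M, (p : P) ∈ J ↔ p ∈ superlevel hanti (m + 1)) ∧
      x = ind (maxSet (removeBelow S) (J : Set P))}.Finite :=
    (Set.finite_range fun J : LowerSet P => ind (maxSet (removeBelow S) (J : Set P))).subset
      (by rintro _ ⟨J, _, rfl⟩; exact ⟨J, rfl⟩)
  refine (convex_convexHull ℝ _).integral_mem (hfin.isClosed_convexHull ℝ) ?_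
    (Integrable.of_eval fun p => hfp p _ (by simp))
  refine (ae_restrict_mem measurableSet_Ioc).mono fun t ht => subset_convexHull ℝ _ ?_
  refine ⟨⟨{p | t ≤ y p}, fun _ _ hab ha => le_trans ha (hyanti hab)⟩, fun p => ?_, ?_⟩
  · change t ≤ y p ↔ _
    rw [mem_superlevel, hyM p]
    -- Integrality of the marking: for `m < t ≤ m + 1`, an integer is at least `t` iff it is at
    -- least `m + 1`.
    constructor
    · intro h
      have : ((m : ℤ) : ℝ) < (μ p : ℤ) := by exact_mod_cast ht.1.trans_le h
      exact Int.add_one_le_iff.2 (by exact_mod_cast this)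
    · intro h
      refine ht.2.trans ?_
      exact_mod_cast h
  · funext p
    exact (ind_maxSet_superlevel hyS hy ((Nat.cast_nonneg m).trans_lt ht.1) p).symm

theorem mem_mrppNonneg_iff [Finite P] {M S : Set P} (hM : IsMarkedSet M) (hMS : M ⊆ S) {μ : M → ℤ}
    (h0 : ∀ p, 0 ≤ μ p) (hμ : IsDominant μ) {x : P → ℝ} :
    x ∈ mrppNonneg M (removeBelow S) μ ↔ (∀ p : M, x p = μ p) ∧ x ∈ chainOrderCone S :=
  ⟨mrppNonneg_subset hMS h0 hμ, fun h => subset_mrppNonneg hM hMS h0 hμ h.1 h.2⟩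

/-- Maximal elements of `P` are marked, so the translation adds `β` on `S` and nothing elsewhere,
and `β` cancels in `x a - x b`. Both signs of `β` are used to undo the shift. -/
theorem add_smul_ind_mem_chainOrderCone [Finite P] {M S : Set P} (hM : IsMarkedSet M) (hMS : M ⊆ S)
    {x : P → ℝ} (hx : x ∈ chainOrderCone S) (β : ℝ) :
    x + β • ind (maxSet (removeBelow S) Set.univ) ∈ chainOrderCone S := by
  have h₁ : ∀ p ∈ S, (x + β • ind (maxSet (removeBelow S) Set.univ)) p = x p + β := by
    intro p hp
    have : p ∈ maxSet (removeBelow S) Set.univ :=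
      mem_maxSet_removeBelow.2 ⟨trivial, Or.inl hp⟩
    simp [ind_apply_of_mem this]
  have h₂ : ∀ p ∉ S, (x + β • ind (maxSet (removeBelow S) Set.univ)) p = x p := by
    intro p hp
    have : p ∉ maxSet (removeBelow S) Set.univ := by
      intro h
      obtain ⟨q, hq⟩ := hM.exists_gt fun h => hp (hMS h)
      exact (mem_maxSet_removeBelow.1 h).2.resolve_left hp q hq trivial
    simp [ind_apply_of_notMem this]
  obtain ⟨hx₀, hx₁⟩ := mem_chainOrderCone.1 hx
  refine mem_chainOrderCone.2 ⟨fun p hp => (h₂ p hp).symm ▸ hx₀ p hp, fun a ha b hb c hc h => ?_⟩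
  rw [h₁ a ha, h₁ b hb, List.map_congr_left fun p hp => h₂ p (hc p hp)]
  have := hx₁ a ha b hb c hc h
  linarith

theorem mcop_eq_mrppShifted [Finite P] {M C O : Set P} {lam : M → ℤ} (hM : IsMarkedSet M)
    (hlam : IsDominant lam) (hCO : Disjoint C O) (hC : C ∪ O = Mᶜ) {β : ℤ}
    (hβ : ∀ p, 0 ≤ lam p + β) :
    mcop M C O lam = mrppShifted M (removeBelow (M ∪ O)) lam β := by
  have hMS : M ⊆ M ∪ O := Set.subset_union_left
  have hdom : IsDominant fun p => lam p + β := fun p q h => by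
    simpa using hlam p q h
  have hv : ∀ p : M, ind (maxSet (removeBelow (M ∪ O)) Set.univ) (p : P) = 1 := fun p =>
    ind_apply_of_mem (mem_maxSet_removeBelow.2 ⟨trivial, Or.inl (hMS p.2)⟩)
  ext x
  rw [mem_mcop_iff hCO hC, mrppShifted, Set.mem_image]
  constructor
  · rintro ⟨h₁, h₂⟩
    refine ⟨x + (β : ℝ) • ind (maxSet (removeBelow (M ∪ O)) Set.univ),
      (mem_mrppNonneg_iff hM hMS hβ hdom).2
        ⟨fun p => ?_, add_smul_ind_mem_chainOrderCone hM hMS h₂ β⟩, add_sub_cancel_right _ _⟩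
    simp [h₁ p, hv p]
  · rintro ⟨y, hy, rfl⟩
    obtain ⟨h₁, h₂⟩ := (mem_mrppNonneg_iff hM hMS hβ hdom).1 hy
    refine ⟨fun p => by simp [h₁ p, hv p], ?_⟩
    simpa [sub_eq_add_neg] using add_smul_ind_mem_chainOrderCone hM hMS h₂ (-(β : ℝ))

theorem mcop_eq_mrpp [Finite P] {M C O : Set P} {lam : M → ℤ} (hM : IsMarkedSet M)
    (hlam : IsDominant lam) (hCO : Disjoint C O) (hC : C ∪ O = Mᶜ) :
    mcop M C O lam = mrpp M (removeBelow (M ∪ O)) lam :=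
  mcop_eq_mrppShifted hM hlam hCO hC (add_markingShift_nonneg lam)

end Transfer

/-! ### Blocks, separated pairs and the flag poset -/

section Flag

variable {l : ℕ} {d : Fin (l + 1) → ℕ}

/-- `i` lies in the block `d k + 1, …, d (k + 1)`. -/
def InBlock (d : Fin (l + 1) → ℕ) (k : Fin l) (i : ℕ) : Prop :=
  d k.castSucc < i ∧ i ≤ d k.succ

/-- The pair `(i, j)` is separated by some `d m`. -/
def IsSeparated (d : Fin (l + 1) → ℕ) (p : ℕ × ℕ) : Prop :=
  ∃ m : Fin (l + 1), m ≠ 0 ∧ m ≠ Fin.last l ∧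
    1 ≤ p.1 ∧ p.1 ≤ d m ∧ d m + 1 ≤ p.2 ∧ p.2 ≤ d (Fin.last l)

/-- The marked elements of the flag poset. -/
def cornerElt (d : Fin (l + 1) → ℕ) (k : Fin l) : flagPoset d := ⟨flagCorner d k, Or.inl ⟨k, rfl⟩⟩

/-- The unmarked elements of the flag poset. -/
def IsSeparated.elt {p : ℕ × ℕ} (h : IsSeparated d p) : flagPoset d := ⟨p, Or.inr h⟩

theorem exists_inBlock (h0 : d 0 = 0) {i : ℕ} (hi : 1 ≤ i) (hi' : i ≤ d (Fin.last l)) :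
    ∃ k, InBlock d k i := by
  have key : ∀ j : Fin (l + 1), i ≤ d j → ∃ k, InBlock d k i := by
    intro j
    induction j using Fin.induction with
    | zero => intro h; omega
    | succ j ih =>
      intro h
      by_cases hj : i ≤ d j.castSucc
      exacts [ih hj, ⟨j, not_le.1 hj, h⟩]
  exact key _ hi'

theorem InBlock.le_iff (hd : StrictMono d) {k : Fin l} {i : ℕ} (h : InBlock d k i)
    (m : Fin (l + 1)) : i ≤ d m ↔ k.succ ≤ m := by
  refine ⟨fun hm => ?_, fun hm => h.2.trans (hd.monotone hm)⟩
  by_contra hk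
  have : m ≤ k.castSucc := by
    rw [not_le] at hk
    exact Fin.le_castSucc_iff.2 hk
  exact absurd (hm.trans (hd.monotone this)) (not_le.2 h.1)

theorem inBlock_corner_fst (hd : StrictMono d) (k : Fin l) : InBlock d k (d k.castSucc + 1) :=
  ⟨Nat.lt_succ_self _, Nat.succ_le_of_lt (hd Fin.castSucc_lt_succ)⟩

theorem inBlock_corner_snd (hd : StrictMono d) (k : Fin l) : InBlock d k (d k.succ) :=
  ⟨hd Fin.castSucc_lt_succ, le_rfl⟩

theorem InBlock.pos {k : Fin l} {i : ℕ} (h : InBlock d k i) : 1 ≤ i :=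
  Nat.succ_le_of_lt ((Nat.zero_le _).trans_lt h.1)

theorem IsSeparated.lt_snd (hd : StrictMono d) {p : ℕ × ℕ} (hp : IsSeparated d p) {k : Fin l}
    {i : ℕ} (h : InBlock d k i) (hi : i ≤ p.1) : d k.succ < p.2 := by
  obtain ⟨m, _, _, _, h₁, h₂, _⟩ := hp
  exact (hd.monotone ((h.le_iff hd m).1 (hi.trans h₁))).trans_lt h₂

theorem IsSeparated.fst_le (hd : StrictMono d) {p : ℕ × ℕ} (hp : IsSeparated d p) {k : Fin l}
    {j : ℕ} (h : InBlock d k j) (hj : p.2 ≤ j) : p.1 ≤ d k.castSucc := by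
  obtain ⟨m, _, _, _, h₁, h₂, _⟩ := hp
  refine h₁.trans (hd.monotone (Fin.le_castSucc_iff.2 (lt_of_not_ge fun hm => ?_)))
  have := (h.le_iff hd m).2 hm
  omega

theorem IsSeparated.fst_lt_snd {p : ℕ × ℕ} (hp : IsSeparated d p) : p.1 < p.2 := by
  obtain ⟨m, _, _, _, h₁, h₂, _⟩ := hp
  omega

theorem IsSeparated.mem_tri {p : ℕ × ℕ} (hp : IsSeparated d p) : p ∈ Tri (d (Fin.last l)) := by
  obtain ⟨m, _, _, h₀, h₁, h₂, h₃⟩ := hp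
  exact ⟨h₀, by omega, h₃⟩

theorem isSeparated_of_lt {p : ℕ × ℕ} (h₁ : 1 ≤ p.1) (h₂ : p.2 ≤ d (Fin.last l))
    {k : Fin l} (h : p.1 ≤ d k.succ) (h' : d k.succ < p.2) : IsSeparated d p := by
  refine ⟨k.succ, Fin.succ_ne_zero k, ?_, h₁, h, h', h₂⟩
  intro hk
  rw [hk] at h'
  omega

/-- Stated for any `i ≤ p.1`, so that one corner, chosen from the start of a Dyck path, lies below
all separated pairs on the path. -/
theorem IsSeparated.corner_lt (hd : StrictMono d) {p : ℕ × ℕ} (hp : IsSeparated d p)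
    {k : Fin l} {i : ℕ} (h : InBlock d k i) (hi : i ≤ p.1) : cornerElt d k < hp.elt := by
  have h₁ := hp.lt_snd hd h hi
  exact Subtype.mk_lt_mk.2 (Prod.lt_iff.2 (Or.inr ⟨(Nat.succ_le_of_lt h.1).trans hi, h₁⟩))

theorem IsSeparated.lt_corner (hd : StrictMono d) {p : ℕ × ℕ} (hp : IsSeparated d p)
    {k : Fin l} {j : ℕ} (h : InBlock d k j) (hj : p.2 ≤ j) : hp.elt < cornerElt d k := by
  have h₁ := hp.fst_le hd h hj
  exact Subtype.mk_lt_mk.2 (Prod.lt_iff.2 (Or.inl ⟨Nat.lt_succ_of_le h₁, hj.trans h.2⟩))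

theorem cornerElt_mem (k : Fin l) : cornerElt d k ∈ flagMarked d := ⟨k, rfl⟩

theorem IsSeparated.elt_notMem (hd : StrictMono d) {p : ℕ × ℕ} (hp : IsSeparated d p) :
    hp.elt ∉ flagMarked d := by
  rintro ⟨k, hk : p = flagCorner d k⟩
  have := hp.lt_snd hd (inBlock_corner_fst hd k) (by rw [hk]; rfl)
  rw [hk] at this
  exact lt_irrefl _ this

theorem isSeparated_of_notMem {p : flagPoset d} (hp : p ∉ flagMarked d) :
    IsSeparated d (p : ℕ × ℕ) :=
  p.2.resolve_left hp

theorem exists_of_mem_flagMarked {p : flagPoset d} (hp : p ∈ flagMarked d) :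
    ∃ k, p = cornerElt d k := by
  obtain ⟨k, hk⟩ := hp
  exact ⟨k, Subtype.ext hk⟩

theorem cornerElt_le_iff (hd : StrictMono d) {j k : Fin l} :
    cornerElt d j ≤ cornerElt d k ↔ j ≤ k := by
  constructor
  · intro h
    have : d j.succ ≤ d k.succ := h.2
    exact Fin.succ_le_succ_iff.1 (hd.le_iff_le.1 this)
  · intro h
    exact ⟨Nat.succ_le_succ (hd.monotone (Fin.castSucc_le_castSucc_iff.2 h)),
      hd.monotone (Fin.succ_le_succ_iff.2 h)⟩

/-- An unmarked pair lies strictly between the corner of its row's block and the corner of its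
column's block. -/
theorem isMarkedSet_flagMarked (hd : StrictMono d) (h0 : d 0 = 0) :
    IsMarkedSet (flagMarked d) := by
  intro p h
  by_contra hp
  have hs := isSeparated_of_notMem hp
  obtain ⟨h₁, h₂, h₃⟩ := hs.mem_tri
  obtain ⟨i, hi⟩ := exists_inBlock h0 h₁ (h₂.trans h₃)
  obtain ⟨j, hj⟩ := exists_inBlock h0 (h₁.trans h₂) h₃
  rcases h with h | h
  · exact (hs.corner_lt hd hi le_rfl).not_ge (h (hs.corner_lt hd hi le_rfl).le)
  · exact (hs.lt_corner hd hj le_rfl).not_ge (h (hs.lt_corner hd hj le_rfl).le)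

theorem flagMarking_cornerElt (hd : StrictMono d) (k : Fin l) :
    flagMarking d ⟨cornerElt d k, cornerElt_mem k⟩ = ∑ i : Fin l, if k ≤ i then 1 else 0 := by
  classical
  refine Finset.sum_congr rfl fun i _ => ?_
  rw [Set.indicator_apply]
  refine if_congr ⟨?_, fun h => ⟨k, h, rfl⟩⟩ rfl rfl
  rintro ⟨j, hj, h⟩
  have : cornerElt d k ≤ cornerElt d j := Subtype.mk_le_mk.2 (le_of_eq h)
  exact ((cornerElt_le_iff hd).1 this).trans hj

/-- The ideals `K_1, …, K_{l-1}` correspond to `ω_{d_1}, …, ω_{d_{l-1}}`; the full ideal `K_l`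
accounts for the extra 1, hence for the shift in the Gelfand–Tsetlin bijection. -/
theorem flagWeight_add_one (hd : StrictMono d) {k : Fin l} {i : ℕ} (h : InBlock d k i) :
    flagWeight d i + 1 = ∑ i : Fin l, if k ≤ i then 1 else 0 := by
  rw [flagWeight, Fin.sum_univ_succ]
  simp only [fundWeight, h.le_iff hd, Fin.succ_le_succ_iff, ne_eq, not_true_eq_false, false_and,
    if_false, zero_add, Fin.succ_ne_zero, not_false_eq_true, true_and]
  cases l with
  | zero => exact k.elim0
  | succ l =>
    rw [Fin.sum_univ_castSucc, Fin.sum_univ_castSucc (n := l)]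
    simp [Fin.le_last, Fin.succ_eq_last_succ, Fin.castSucc_ne_last]

theorem flagMarking_eq (hd : StrictMono d) {k : Fin l} {i : ℕ} (h : InBlock d k i) :
    flagMarking d ⟨cornerElt d k, cornerElt_mem k⟩ = flagWeight d i + 1 := by
  rw [flagMarking_cornerElt hd, flagWeight_add_one hd h]

theorem flagWeight_antitone (d : Fin (l + 1) → ℕ) : Antitone (flagWeight d) := by
  intro i j h
  refine Finset.sum_le_sum fun m _ => ?_
  unfold fundWeight
  split_ifs <;> omega

theorem flagWeight_eq (hd : StrictMono d) {k : Fin l} {i j : ℕ} (hi : InBlock d k i)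
    (hj : InBlock d k j) : flagWeight d i = flagWeight d j :=
  add_right_cancel ((flagWeight_add_one hd hi).trans (flagWeight_add_one hd hj).symm)

theorem isDominant_flagMarking (hd : StrictMono d) : IsDominant (flagMarking d) := by
  rintro ⟨p, hp⟩ ⟨q, hq⟩ h
  obtain ⟨j, rfl⟩ := exists_of_mem_flagMarked hp
  obtain ⟨k, rfl⟩ := exists_of_mem_flagMarked hq
  have hjk : j ≤ k := (cornerElt_le_iff hd).1 h.le
  rw [flagMarking_cornerElt hd, flagMarking_cornerElt hd]
  refine Finset.sum_le_sum fun i _ => ?_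
  split_ifs <;> omega

/-! ### Arrays and points indexed by the flag poset -/

section Extend

variable {n : ℕ}

theorem flagExtend_of_isSeparated (hd : StrictMono d) (c : Tri n → ℝ) (x : flagPoset d → ℝ)
    {t : Tri n} (h : IsSeparated d t) : flagExtend d c x t = x h.elt := by
  have h₁ : (t : ℕ × ℕ) ∈ flagPoset d := Or.inr h
  have h₂ : (⟨t, h₁⟩ : flagPoset d) ∉ flagMarked d := h.elt_notMem hd
  rw [flagExtend, dif_pos h₁, if_neg h₂]
  rfl

theorem flagExtend_of_not_isSeparated (c : Tri n → ℝ) (x : flagPoset d → ℝ)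
    {t : Tri n} (h : ¬ IsSeparated d t) : flagExtend d c x t = c t := by
  rw [flagExtend]
  split_ifs with h₁ h₂
  · rfl
  · exact absurd (isSeparated_of_notMem h₂) h
  · rfl

/-- The array forgets the marked coordinates, but these are prescribed. -/
theorem flagExtend_injOn (hd : StrictMono d) (hn : d (Fin.last l) = n) (c : Tri n → ℝ)
    (lam : flagMarked d → ℝ) {x y : flagPoset d → ℝ} (hx : ∀ p : flagMarked d, x p = lam p)
    (hy : ∀ p : flagMarked d, y p = lam p) (h : flagExtend d c x = flagExtend d c y) : x = y := by
  funext p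
  by_cases hp : p ∈ flagMarked d
  · exact (hx ⟨p, hp⟩).trans (hy ⟨p, hp⟩).symm
  · have hs := isSeparated_of_notMem hp
    have := congrFun h ⟨p, hn ▸ hs.mem_tri⟩
    rwa [flagExtend_of_isSeparated hd _ _ hs, flagExtend_of_isSeparated hd _ _ hs] at this

theorem exists_inBlock_of_not_isSeparated (h0 : d 0 = 0) (hn : d (Fin.last l) = n) {t : Tri n}
    (h : ¬ IsSeparated d t) :
    ∃ k, InBlock d k (t : ℕ × ℕ).1 ∧ InBlock d k (t : ℕ × ℕ).2 := by
  obtain ⟨h₁, h₂, h₃⟩ := t.2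
  obtain ⟨k, hk⟩ := exists_inBlock h0 h₁ ((h₂.trans h₃).trans hn.ge)
  refine ⟨k, hk, hk.1.trans_le h₂, not_lt.1 fun hlt => h ?_⟩
  exact isSeparated_of_lt h₁ (h₃.trans hn.ge) hk.2 hlt

/-- An array which agrees with `c` at the pairs that are not separated comes from the flag poset. -/
theorem exists_flagExtend_eq (hd : StrictMono d) (hn : d (Fin.last l) = n) {c z : Tri n → ℝ}
    (lam : flagMarked d → ℝ) (a : ℝ) (hz : ∀ t : Tri n, ¬ IsSeparated d t → z t = c t) :
    ∃ x : flagPoset d → ℝ, (∀ p : flagMarked d, x p = lam p) ∧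
      (∀ (t : Tri n) (h : IsSeparated d t), x h.elt = z t + a) ∧
      flagExtend d c (fun p => x p - a) = z := by
  classical
  have hmem : ∀ p : flagPoset d, p ∉ flagMarked d → (p : ℕ × ℕ) ∈ Tri n := fun p hp =>
    hn ▸ (isSeparated_of_notMem hp).mem_tri
  have key : ∀ (t : Tri n) (h : IsSeparated d t),
      (if hp : h.elt ∈ flagMarked d then lam ⟨h.elt, hp⟩ else z ⟨_, hmem _ hp⟩ + a) = z t + a :=
    fun t h => dif_neg (h.elt_notMem hd)
  refine ⟨fun p => if hp : p ∈ flagMarked d then lam ⟨p, hp⟩ else z ⟨p, hmem p hp⟩ + a,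
    fun p => dif_pos p.2, key, ?_⟩
  funext t
  by_cases h : IsSeparated d t
  · rw [flagExtend_of_isSeparated hd _ _ h]
    exact (congrArg (· - a) (key t h)).trans (add_sub_cancel_right _ _)
  · rw [flagExtend_of_not_isSeparated _ _ h, hz t h]

end Extend

end Flag

/-! ### The Gelfand–Tsetlin polytope as a marked order polytope -/

section GelfandTsetlin

theorem mem_mcop_empty_iff {P : Type*} [PartialOrder P] {M : Set P} {lam : M → ℤ} {x : P → ℝ} :
    x ∈ mcop M ∅ Mᶜ lam ↔ (∀ p : M, x p = lam p) ∧ Antitone x := by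
  refine and_congr_right fun _ => ⟨fun h p q hpq => ?_, fun h => ⟨fun p hp => hp.elim, ?_⟩⟩
  · rcases hpq.eq_or_lt with rfl | hpq
    · exact le_rfl
    · have := h.2 p (by simp) q (by simp) [] (by simp) (by simpa using hpq)
      simpa using this
  · intro a _ b _ c hc hch
    obtain rfl : c = [] := List.eq_nil_iff_forall_not_mem.2 hc
    simpa using h (le_of_lt (by simpa using hch : a < b))

theorem antitone_of_mem_gtPolytope {n : ℕ} {μ : ℕ → ℤ} {z : Tri n → ℝ}
    (hz : z ∈ gtPolytope n μ) : Antitone z := by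
  have key : ∀ (N : ℕ) (p q : Tri n), p ≤ q →
      ((q : ℕ × ℕ).1 - (p : ℕ × ℕ).1) + ((q : ℕ × ℕ).2 - (p : ℕ × ℕ).2) = N → z q ≤ z p := by
    intro N
    induction N with
    | zero =>
      rintro p q ⟨h₁, h₂⟩ hN
      have : p = q := Subtype.ext (Prod.ext (by omega) (by omega))
      rw [this]
    | succ N ih =>
      rintro ⟨⟨i, j⟩, hp⟩ ⟨⟨i', j'⟩, hq⟩ ⟨h₁, h₂⟩ hN
      simp only [Tri, Set.mem_ofPred_eq] at hp hq h₁ h₂ hN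
      -- Raising `j` before `i` keeps the path inside the triangle: once `j = j'`, one has `i + 1 ≤
      -- i' ≤ j`.
      by_cases h : j < j'
      · let r : Tri n := ⟨(i, j + 1), hp.1, by dsimp only; omega, by dsimp only; omega⟩
        exact (ih r ⟨(i', j'), hq⟩ ⟨h₁, h⟩ (by dsimp only [r]; omega)).trans (hz.2 _ r (Or.inl rfl))
      · let r : Tri n := ⟨(i + 1, j), by simp, by dsimp only; omega, hp.2.2⟩
        exact (ih r ⟨(i', j'), hq⟩ ⟨by dsimp only [r]; omega, h₂⟩ (by dsimp only [r]; omega)).trans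
          (hz.2 _ r (Or.inr rfl))
  exact fun p q h => key _ p q h rfl

theorem TriStep.le {n : ℕ} {p q : Tri n} (h : TriStep p q) : p ≤ q := by
  rcases h with h | h
  · exact Subtype.mk_le_mk.2 (h ▸ ⟨le_rfl, Nat.le_succ _⟩)
  · exact Subtype.mk_le_mk.2 (h ▸ ⟨Nat.le_succ _, le_rfl⟩)

theorem TriStep.lt {n : ℕ} {p q : Tri n} (h : TriStep p q) : p < q := by
  refine h.le.lt_of_ne ?_
  rintro rfl
  rcases h with h | h
  · exact absurd (congrArg Prod.snd h) (by simp)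
  · exact absurd (congrArg Prod.fst h) (by simp)

variable {n l : ℕ} {d : Fin (l + 1) → ℕ}

/-- A separated pair is squeezed between two corners, and their markings are the weights plus 1.
This handles steps with an end outside the separated region. -/
theorem flagExtend_gt_bounds (hd : StrictMono d) (h0 : d 0 = 0) (hn : d (Fin.last l) = n)
    {x : flagPoset d → ℝ} (hx : ∀ p : flagMarked d, x p = flagMarking d p) (hanti : Antitone x)
    (t : Tri n) :
    flagExtend (n := n) d (fun t => flagWeight d (t : ℕ × ℕ).1) (fun p => x p - 1) t
        ≤ flagWeight d (t : ℕ × ℕ).1 ∧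
      (flagWeight d (t : ℕ × ℕ).2 : ℝ) ≤
        flagExtend (n := n) d (fun t => flagWeight d (t : ℕ × ℕ).1) (fun p => x p - 1) t := by
  by_cases h : IsSeparated d t
  · obtain ⟨h₁, h₂, h₃⟩ := h.mem_tri
    obtain ⟨i, hi⟩ := exists_inBlock h0 h₁ (h₂.trans h₃)
    obtain ⟨j, hj⟩ := exists_inBlock h0 (h₁.trans h₂) h₃
    have hi' := hanti (h.corner_lt hd hi le_rfl).le
    have hj' := hanti (h.lt_corner hd hj le_rfl).le
    have ei := hx ⟨_, cornerElt_mem i⟩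
    have ej := hx ⟨_, cornerElt_mem j⟩
    rw [flagMarking_eq hd hi] at ei
    rw [flagMarking_eq hd hj] at ej
    rw [flagExtend_of_isSeparated hd _ _ h]
    push_cast at ei ej
    constructor <;> linarith
  · obtain ⟨k, h₁, h₂⟩ := exists_inBlock_of_not_isSeparated h0 hn h
    rw [flagExtend_of_not_isSeparated _ _ h, flagWeight_eq hd h₁ h₂]
    exact ⟨le_rfl, le_rfl⟩

theorem bijOn_gtPolytope (hd : StrictMono d) (h0 : d 0 = 0) (hn : d (Fin.last l) = n) :
    Set.BijOn
      (fun x : flagPoset d → ℝ =>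
        flagExtend (n := n) d (fun t => flagWeight d (t : ℕ × ℕ).1) (fun p => x p - 1))
      (mcop (flagMarked d) ∅ (flagMarked d)ᶜ (flagMarking d))
      (gtPolytope n (flagWeight d)) := by
  refine ⟨fun x hx => ?_, fun x hx y hy hxy => ?_, fun z hz => ?_⟩
  · obtain ⟨hx, hanti⟩ := mem_mcop_empty_iff.1 hx
    refine ⟨fun p hp => ?_, fun p q hpq => ?_⟩
    · exact flagExtend_of_not_isSeparated _ _ fun h => h.fst_lt_snd.ne hp
    have hw := flagWeight_antitone d
    have hle : (p : ℕ × ℕ) ≤ q := hpq.le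
    by_cases hp : IsSeparated d p
    · by_cases hq : IsSeparated d q
      · simp only [flagExtend_of_isSeparated hd _ _ hp, flagExtend_of_isSeparated hd _ _ hq]
        exact sub_le_sub_right (hanti (Subtype.mk_le_mk.2 hle)) 1
      · obtain ⟨k, h₁, h₂⟩ := exists_inBlock_of_not_isSeparated h0 hn hq
        refine le_trans ?_ (flagExtend_gt_bounds hd h0 hn hx hanti p).2
        simp only [flagExtend_of_not_isSeparated _ _ hq, flagWeight_eq hd h₁ h₂]
        exact_mod_cast hw hle.2
    · refine (flagExtend_gt_bounds hd h0 hn hx hanti q).1.trans ?_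
      simp only [flagExtend_of_not_isSeparated _ _ hp]
      exact_mod_cast hw hle.1
  · have := flagExtend_injOn (x := fun p => x p - 1) (y := fun p => y p - 1) hd hn _
      (fun p => flagMarking d p - 1) (fun p => by rw [(mem_mcop_empty_iff.1 hx).1 p])
      (fun p => by rw [(mem_mcop_empty_iff.1 hy).1 p]) hxy
    funext p
    exact sub_left_injective (congrFun this p)
  · have hanti := antitone_of_mem_gtPolytope hz
    -- `z t` lies between the diagonal entries of its row and its column, which agree within a
    -- block.
    have hzw : ∀ (t : Tri n) (k : Fin l), InBlock d k (t : ℕ × ℕ).1 → InBlock d k (t : ℕ × ℕ).2 →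
        z t = flagWeight d (t : ℕ × ℕ).1 := by
      rintro ⟨⟨i, j⟩, h₁, h₂, h₃⟩ k hi hj
      refine le_antisymm ?_ ?_
      · have e := hz.1 ⟨(i, i), h₁, le_rfl, h₂.trans h₃⟩ rfl
        rw [← e]
        exact hanti ⟨le_rfl, h₂⟩
      · have e := hz.1 ⟨(j, j), h₁.trans h₂, le_rfl, h₃⟩ rfl
        simp only [flagWeight_eq hd hi hj]
        rw [← e]
        exact hanti ⟨h₂, le_rfl⟩
    obtain ⟨x, hx, hxs, hxz⟩ := exists_flagExtend_eq hd hn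
      (c := fun t : Tri n => (flagWeight d (t : ℕ × ℕ).1 : ℝ)) (z := z)
      (fun p => flagMarking d p) 1 fun t ht => by
        obtain ⟨k, h₁, h₂⟩ := exists_inBlock_of_not_isSeparated h0 hn ht
        exact hzw t k h₁ h₂
    -- The corners also satisfy `x = z + 1`, so antitonicity of `z` transfers to all of `x` at once.
    have hxz' : ∀ p : flagPoset d, ∃ h : (p : ℕ × ℕ) ∈ Tri n, x p = z ⟨p, h⟩ + 1 := by
      intro p
      by_cases hp : p ∈ flagMarked d
      · obtain ⟨k, rfl⟩ := exists_of_mem_flagMarked hp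
        have h₁ := inBlock_corner_fst hd k
        have h₂ := inBlock_corner_snd hd k
        refine ⟨⟨h₁.pos, h₁.2, hn ▸ hd.monotone (Fin.le_last _)⟩, ?_⟩
        rw [hx ⟨_, hp⟩, hzw _ k h₁ h₂, flagMarking_eq hd h₁]
        push_cast
        rfl
      · have hs := isSeparated_of_notMem hp
        exact ⟨hn ▸ hs.mem_tri, hxs ⟨p, hn ▸ hs.mem_tri⟩ hs⟩
    refine ⟨x, mem_mcop_empty_iff.2 ⟨hx, fun p q hpq => ?_⟩, hxz⟩
    obtain ⟨hp, ep⟩ := hxz' p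
    obtain ⟨hq, eq⟩ := hxz' q
    rw [ep, eq]
    exact add_le_add_left (hanti (Subtype.mk_le_mk.2 hpq)) 1

end GelfandTsetlin

/-! ### The FFLV polytope as a marked chain polytope -/

section FFLV

variable {n l : ℕ} {d : Fin (l + 1) → ℕ}

/-- `c` is a path of positive roots from `p` to `e`. -/
def IsRootPath (p : Tri n) (e : ℕ × ℕ) (c : List (Tri n)) : Prop :=
  (∀ q ∈ c, (q : ℕ × ℕ).1 < (q : ℕ × ℕ).2) ∧ List.IsChain TriStep c ∧ c.head? = some p ∧
    c.getLast?.map Subtype.val = some e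

theorem IsRootPath.cons {p q : Tri n} {e : ℕ × ℕ} {c : List (Tri n)} (h : IsRootPath q e c)
    (hp : (p : ℕ × ℕ).1 < (p : ℕ × ℕ).2) (hpq : TriStep p q) : IsRootPath p e (p :: c) := by
  obtain ⟨h₁, h₂, h₃, h₄⟩ := h
  refine ⟨fun r hr => ?_, List.isChain_cons.2 ⟨fun r hr => ?_, h₂⟩, rfl, ?_⟩
  · rcases List.mem_cons.1 hr with rfl | hr
    exacts [hp, h₁ r hr]
  · rw [h₃] at hr
    exact Option.mem_some.1 hr ▸ hpq
  · cases c with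
    | nil => simp at h₃
    | cons a c => rwa [List.getLast?_cons_cons]

theorem exists_pred {p q : Tri n} (hp : (p : ℕ × ℕ).1 < (p : ℕ × ℕ).2)
    (hpq : p < q) : ∃ r : Tri n, p ≤ r ∧ (r : ℕ × ℕ).1 < (r : ℕ × ℕ).2 ∧ TriStep r q := by
  obtain ⟨⟨i, j⟩, hi⟩ := p
  obtain ⟨⟨i', j'⟩, hi'⟩ := q
  simp only [Subtype.mk_lt_mk, Prod.mk_lt_mk] at hpq
  simp only [Tri, Set.mem_ofPred_eq] at hp hi hi'
  by_cases h : i < i'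
  · refine ⟨⟨(i' - 1, j'), by dsimp only; omega, by dsimp only; omega, hi'.2.2⟩, ⟨?_, ?_⟩, ?_,
      Or.inr (Prod.ext ?_ rfl)⟩ <;> dsimp only <;> omega
  · refine ⟨⟨(i, j' - 1), hi.1, by dsimp only; omega, by dsimp only; omega⟩, ⟨le_rfl, ?_⟩, ?_,
      Or.inl (Prod.ext ?_ ?_)⟩ <;> dsimp only <;> omega

/-- Walk back from `q` to `p` by unit steps off the diagonal; the entries added are nonnegative, and
`z p` is among them when `p ≠ q`. -/
theorem IsRootPath.exists_prepend {z : Tri n → ℝ}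
    (hz : ∀ p : Tri n, (p : ℕ × ℕ).1 < (p : ℕ × ℕ).2 → 0 ≤ z p) {p : Tri n}
    (hp : (p : ℕ × ℕ).1 < (p : ℕ × ℕ).2) {e : ℕ × ℕ} (q : Tri n) :
    ∀ c : List (Tri n), IsRootPath q e c → p ≤ q →
      ∃ c', IsRootPath p e c' ∧ (c.map z).sum ≤ (c'.map z).sum ∧
        (p ≠ q → z p + (c.map z).sum ≤ (c'.map z).sum) := by
  induction q using WellFoundedLT.induction with
  | ind q ih =>
    intro c hc hpq
    rcases hpq.eq_or_lt with rfl | hlt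
    · exact ⟨c, hc, le_rfl, fun h => absurd rfl h⟩
    obtain ⟨r, hpr, hr, hrq⟩ := exists_pred hp hlt
    obtain ⟨c', hc', h₁, h₂⟩ := ih r hrq.lt (r :: c) (hc.cons hr hrq) hpr
    rw [List.map_cons, List.sum_cons] at h₁ h₂
    have hzr := hz r hr
    refine ⟨c', hc', by linarith, fun _ => ?_⟩
    by_cases h : p = r
    · rw [h]
      exact h₁
    · have := h₂ h
      linarith

/-- Gaps in the chain are filled by nonnegative entries. The clause for `p ∉ L` carries the
induction: applied to the head of the chain and its tail, it counts the head exactly once. -/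
theorem exists_isRootPath {z : Tri n → ℝ}
    (hz : ∀ p : Tri n, (p : ℕ × ℕ).1 < (p : ℕ × ℕ).2 → 0 ≤ z p) {e : Tri n}
    (he : (e : ℕ × ℕ).1 < (e : ℕ × ℕ).2) :
    ∀ (L : List (Tri n)) (p : Tri n), (p : ℕ × ℕ).1 < (p : ℕ × ℕ).2 → p ≤ e →
      (∀ q ∈ L, (q : ℕ × ℕ).1 < (q : ℕ × ℕ).2 ∧ q ≤ e ∧ p ≤ q) → L.Pairwise (· < ·) →
      ∃ c, IsRootPath p e c ∧ (L.map z).sum ≤ (c.map z).sum ∧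
        (p ∉ L → z p + (L.map z).sum ≤ (c.map z).sum)
  | [], p, hp, hpe, _, _ => by
    have hpath : IsRootPath e e [e] := ⟨by simpa using he, by simp, by simp, by simp⟩
    obtain ⟨c, hc, h₁, h₂⟩ := IsRootPath.exists_prepend hz hp e [e] hpath hpe
    have hze := hz e he
    simp only [List.map_cons, List.map_nil, List.sum_cons, List.sum_nil, add_zero] at h₁ h₂ ⊢
    refine ⟨c, hc, hze.trans h₁, fun _ => ?_⟩
    by_cases h : p = e
    · rw [h]
      exact h₁
    · have := h₂ h
      linarith
  | q :: L, p, hp, _, hL, hpair => by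
    rw [List.pairwise_cons] at hpair
    obtain ⟨hq, hqe, hpq⟩ := hL q (by simp)
    obtain ⟨c, hc, _, h₁⟩ := exists_isRootPath hz he L q hq hqe
      (fun r hr => ⟨(hL r (by simp [hr])).1, (hL r (by simp [hr])).2.1, (hpair.1 r hr).le⟩) hpair.2
    have h₁ := h₁ fun h => lt_irrefl _ (hpair.1 q h)
    obtain ⟨c', hc', h₂, h₃⟩ := hc.exists_prepend hz hp q c hpq
    rw [List.map_cons, List.sum_cons]
    refine ⟨c', hc', h₁.trans h₂, fun h => ?_⟩
    have := h₃ fun hpq => h (by simp [hpq])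
    linarith

/-- Extends the Dyck path bound to arbitrary chains in the box: an off-diagonal pair in row at least
`i` has column at least `i + 1`, so it lies above `(i, i + 1)`, and dually for the end. -/
theorem sum_le_of_mem_fflvPolytope {μ : ℕ → ℤ} {z : Tri n → ℝ} (hz : z ∈ fflvPolytope n μ)
    {i j : ℕ} (hi : 1 ≤ i) (hij : i ≤ j) (hj : j + 1 ≤ n) {L : List (Tri n)}
    (hL : ∀ q ∈ L, (q : ℕ × ℕ).1 < (q : ℕ × ℕ).2 ∧ i ≤ (q : ℕ × ℕ).1 ∧ (q : ℕ × ℕ).2 ≤ j + 1)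
    (hpair : L.Pairwise (· < ·)) : (L.map z).sum ≤ (μ i : ℝ) - μ (j + 1) := by
  let p : Tri n := ⟨(i, i + 1), hi, by simp, by dsimp only; omega⟩
  let e : Tri n := ⟨(j, j + 1), by dsimp only; omega, by simp, hj⟩
  obtain ⟨c, ⟨h₁, h₂, h₃, h₄⟩, h, _⟩ := exists_isRootPath hz.2.1 (e := e) (by simp [e]) L p
    (by simp [p]) ⟨hij, Nat.succ_le_succ hij⟩ (fun q hq => by
      obtain ⟨h₁, h₂, h₃⟩ := hL q hq
      exact ⟨h₁, ⟨by dsimp only [e]; omega, h₃⟩, ⟨h₂, by dsimp only [p]; omega⟩⟩) hpair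
  exact h.trans (hz.2.2 i j c h₁ h₂ (by rw [h₃]; rfl) h₄)

theorem mem_mcop_compl_empty_iff {P : Type*} [PartialOrder P] {M : Set P} {lam : M → ℤ}
    {x : P → ℝ} :
    x ∈ mcop M Mᶜ ∅ lam ↔ (∀ p : M, x p = lam p) ∧ (∀ p ∉ M, 0 ≤ x p) ∧
      ∀ a b : M, ∀ c : List P, (∀ p ∈ c, p ∉ M) →
        ((a : P) :: (c ++ [(b : P)])).Pairwise (· < ·) → (c.map x).sum ≤ lam a - lam b := by
  refine and_congr_right fun hM => and_congr_right fun _ => ⟨fun h a b c hc hch => ?_, ?_⟩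
  · rw [← hM a, ← hM b]
    exact h a (Or.inl a.2) b (Or.inl b.2) c hc hch.isChain
  · rintro h a ha b hb c hc hch
    rw [Set.union_empty] at ha hb
    have := h ⟨a, ha⟩ ⟨b, hb⟩ c hc hch.pairwise
    rwa [← hM ⟨a, ha⟩, ← hM ⟨b, hb⟩] at this

/-- A sum over a list of off-diagonal pairs only involves the separated ones. -/
theorem sum_map_flagExtend (hd : StrictMono d) {c : Tri n → ℝ}
    (hc : ∀ t : Tri n, (t : ℕ × ℕ).1 < (t : ℕ × ℕ).2 → c t = 0) (x : flagPoset d → ℝ) :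
    ∀ L : List (Tri n), (∀ t ∈ L, (t : ℕ × ℕ).1 < (t : ℕ × ℕ).2) → L.Pairwise (· < ·) →
      ∃ L' : List (flagPoset d), (L'.map x).sum = (L.map (flagExtend d c x)).sum ∧
        (∀ q ∈ L', ∃ t ∈ L, ∃ h : IsSeparated d t, q = h.elt) ∧ L'.Pairwise (· < ·)
  | [], _, _ => ⟨[], by simp⟩
  | t :: L, hL, hpair => by
    rw [List.pairwise_cons] at hpair
    obtain ⟨L', h₁, h₂, h₃⟩ :=
      sum_map_flagExtend hd hc x L (fun s hs => hL s (by simp [hs])) hpair.2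
    by_cases ht : IsSeparated d t
    · refine ⟨ht.elt :: L', ?_, fun q hq => ?_, List.pairwise_cons.2 ⟨fun q hq => ?_, h₃⟩⟩
      · rw [List.map_cons, List.map_cons, List.sum_cons, List.sum_cons, h₁,
          flagExtend_of_isSeparated hd _ _ ht]
      · rcases List.mem_cons.1 hq with rfl | hq
        · exact ⟨t, by simp, ht, rfl⟩
        · obtain ⟨s, hs, h⟩ := h₂ q hq
          exact ⟨s, by simp [hs], h⟩
      · obtain ⟨s, hs, h, rfl⟩ := h₂ q hq
        exact Subtype.mk_lt_mk.2 (hpair.1 s hs)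
    · refine ⟨L', ?_, fun q hq => ?_, h₃⟩
      · rw [List.map_cons, List.sum_cons, h₁, flagExtend_of_not_isSeparated _ _ ht,
          hc t (hL t (by simp)), zero_add]
      · obtain ⟨s, hs, h⟩ := h₂ q hq
        exact ⟨s, by simp [hs], h⟩

theorem le_of_isChain_triStep {c : List (Tri n)} (hc : List.IsChain TriStep c) {s e : ℕ × ℕ}
    (hs : c.head?.map Subtype.val = some s) (he : c.getLast?.map Subtype.val = some e) :
    ∀ t ∈ c, s ≤ t ∧ (t : ℕ × ℕ) ≤ e := by
  have hpair : c.Pairwise (· ≤ ·) := (hc.imp fun _ _ h => h.le).pairwise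
  intro t ht
  constructor
  · cases c with
    | nil => simp at ht
    | cons a c =>
      obtain rfl : (a : ℕ × ℕ) = s := by simpa using hs
      rcases List.mem_cons.1 ht with rfl | ht
      exacts [le_rfl, (List.pairwise_cons.1 hpair).1 t ht]
  · rcases c.eq_nil_or_concat' with rfl | ⟨c, a, rfl⟩
    · simp at ht
    · obtain rfl : (a : ℕ × ℕ) = e := by simpa using he
      rcases List.mem_append.1 ht with ht | ht
      · exact (List.pairwise_append.1 hpair).2.2 t ht a (by simp)
      · rw [List.mem_singleton.1 ht]

theorem bijOn_fflvPolytope (hd : StrictMono d) (h0 : d 0 = 0) (hn : d (Fin.last l) = n) :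
    Set.BijOn
      (flagExtend (n := n) d (fun t => if (t : ℕ × ℕ).1 = (t : ℕ × ℕ).2
        then (flagWeight d (t : ℕ × ℕ).1 : ℝ) else 0))
      (mcop (flagMarked d) (flagMarked d)ᶜ ∅ (flagMarking d))
      (fflvPolytope n (flagWeight d)) := by
  refine ⟨fun x hx => ?_, fun x hx y hy hxy => ?_, fun z hz => ?_⟩
  · obtain ⟨hx, hx₀, hx₁⟩ := mem_mcop_compl_empty_iff.1 hx
    refine ⟨fun p hp => ?_, fun p hp => ?_, fun i j c hc hch hs he => ?_⟩
    · rw [flagExtend_of_not_isSeparated _ _ fun h => h.fst_lt_snd.ne hp, if_pos hp]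
    · by_cases h : IsSeparated d p
      · rw [flagExtend_of_isSeparated hd _ _ h]
        exact hx₀ _ (h.elt_notMem hd)
      · rw [flagExtend_of_not_isSeparated _ _ h, if_neg hp.ne]
    have hbd := le_of_isChain_triStep hch hs he
    obtain ⟨L, hL, hLc, hLp⟩ := sum_map_flagExtend (n := n) hd
      (c := fun t => if (t : ℕ × ℕ).1 = (t : ℕ × ℕ).2
        then (flagWeight d (t : ℕ × ℕ).1 : ℝ) else 0) (fun t ht => if_neg ht.ne) x c hc
      (hch.imp fun _ _ h => h.lt).pairwise
    rw [← hL]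
    -- Without separated pairs on the path the two corners may coincide, so antitonicity of the
    -- weight replaces the chain inequality.
    rcases L.eq_nil_or_concat' with rfl | ⟨L', q, hLq⟩
    · obtain ⟨a, ha, _⟩ := Option.map_eq_some_iff.1 hs
      have hij := hbd a (List.mem_of_mem_head? ha)
      have : i ≤ j + 1 := (hij.1.1.trans hij.2.1).trans (Nat.le_succ j)
      simp only [List.map_nil, List.sum_nil, sub_nonneg, Int.cast_le]
      exact flagWeight_antitone d this
    · obtain ⟨a, ha, has⟩ := Option.map_eq_some_iff.1 hs
      obtain ⟨b, hb, hbe⟩ := Option.map_eq_some_iff.1 he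
      have ha' := a.2
      have hb' := b.2
      rw [has] at ha'
      rw [hbe] at hb'
      obtain ⟨k, hk⟩ := exists_inBlock (d := d) h0 (i := i) ha'.1
        ((Nat.le_succ i).trans (ha'.2.2.trans hn.ge))
      obtain ⟨m, hm⟩ := exists_inBlock (d := d) h0 (i := j + 1) (Nat.succ_pos j)
        (hb'.2.2.trans hn.ge)
      have h₁ : ∀ q ∈ L, cornerElt d k < q := by
        intro q hq
        obtain ⟨t, ht, h, rfl⟩ := hLc q hq
        exact h.corner_lt hd hk (hbd t ht).1.1
      have h₂ : ∀ q ∈ L, q < cornerElt d m := by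
        intro q hq
        obtain ⟨t, ht, h, rfl⟩ := hLc q hq
        exact h.lt_corner hd hm (hbd t ht).2.2
      have hqL : q ∈ L := by rw [hLq]; simp
      have := hx₁ ⟨_, cornerElt_mem k⟩ ⟨_, cornerElt_mem m⟩ L
        (fun q hq => by
          obtain ⟨t, ht, h, rfl⟩ := hLc q hq
          exact h.elt_notMem hd)
        (List.pairwise_cons.2 ⟨fun r hr => by
            rcases List.mem_append.1 hr with hr | hr
            · exact h₁ r hr
            · rw [List.mem_singleton.1 hr]
              exact (h₁ q hqL).trans (h₂ q hqL),
          List.pairwise_append.2 ⟨hLp, by simp, fun r hr s hs => by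
            rw [List.mem_singleton.1 hs]
            exact h₂ r hr⟩⟩)
      rw [flagMarking_eq hd hk, flagMarking_eq hd hm] at this
      push_cast at this
      linarith
  · exact flagExtend_injOn hd hn _ (fun p => flagMarking d p) (mem_mcop_compl_empty_iff.1 hx).1
      (mem_mcop_compl_empty_iff.1 hy).1 hxy
  · have hzw : ∀ t : Tri n, ¬ IsSeparated d t → z t = if (t : ℕ × ℕ).1 = (t : ℕ × ℕ).2
        then (flagWeight d (t : ℕ × ℕ).1 : ℝ) else 0 := by
      intro t ht
      split_ifs with h
      · exact hz.1 t h
      · obtain ⟨k, h₁, h₂⟩ := exists_inBlock_of_not_isSeparated h0 hn ht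
        obtain ⟨t₁, t₂, t₃⟩ := t.2
        have hlt := t₂.lt_of_ne h
        refine le_antisymm ?_ (hz.2.1 t hlt)
        have hj : (t : ℕ × ℕ).2 - 1 + 1 = (t : ℕ × ℕ).2 := by omega
        -- The one-element chain gives `z t ≤ μ_i - μ_j`, which is 0 within a block.
        have := sum_le_of_mem_fflvPolytope hz (i := (t : ℕ × ℕ).1) (j := (t : ℕ × ℕ).2 - 1)
          (L := [t]) t₁ (by omega) (by omega)
          (fun q hq => by
            rw [List.mem_singleton.1 hq]
            exact ⟨hlt, le_rfl, hj.ge⟩) (by simp)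
        rw [hj, flagWeight_eq hd h₁ h₂] at this
        simpa using this
    obtain ⟨x, hx, hxs, hxz⟩ := exists_flagExtend_eq hd hn (z := z) (fun p => flagMarking d p) 0 hzw
    simp only [sub_zero, add_zero] at hxs hxz
    have hxs' : ∀ p (hp : p ∉ flagMarked d),
        x p = z ⟨p, hn ▸ (isSeparated_of_notMem hp).mem_tri⟩ := fun p hp =>
      hxs ⟨p, hn ▸ (isSeparated_of_notMem hp).mem_tri⟩ (isSeparated_of_notMem hp)
    refine ⟨x, mem_mcop_compl_empty_iff.2 ⟨hx, fun p hp => ?_, ?_⟩, hxz⟩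
    · rw [hxs' p hp]
      exact hz.2.1 _ (isSeparated_of_notMem hp).fst_lt_snd
    rintro ⟨a, ha⟩ ⟨b, hb⟩ c hc hpair
    obtain ⟨k, rfl⟩ := exists_of_mem_flagMarked ha
    obtain ⟨m, rfl⟩ := exists_of_mem_flagMarked hb
    have hk := inBlock_corner_fst hd k
    have hm := inBlock_corner_snd hd m
    have hkm : cornerElt d k < cornerElt d m :=
      (List.pairwise_cons.1 hpair).1 (cornerElt d m) (by simp)
    have hlt : k < m := ((cornerElt_le_iff hd).1 hkm.le).lt_of_ne fun h =>
      hkm.ne (congrArg (cornerElt d) h)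
    have hdlt : d k.succ < d m.succ := hd (Fin.succ_lt_succ_iff.2 hlt)
    have hmn : d m.succ ≤ n := hn ▸ hd.monotone (Fin.le_last _)
    rw [flagMarking_eq hd hk, flagMarking_eq hd hm]
    have hj : d m.succ - 1 + 1 = d m.succ := by omega
    let g : {p // p ∈ c} → Tri n := fun p =>
      ⟨p.1, hn ▸ (isSeparated_of_notMem (hc p.1 p.2)).mem_tri⟩
    have hsum : (c.map x).sum = ((c.attach.map g).map z).sum := by
      conv_lhs => rw [← c.attach_map_subtype_val, List.map_map]
      rw [List.map_map]
      exact congrArg List.sum (List.map_congr_left fun p _ => hxs' p.1 (hc p.1 p.2))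
    -- The box is spanned by the row of the lower corner and the column of the upper one; `k < m`
    -- makes it nondegenerate.
    have := sum_le_of_mem_fflvPolytope hz (i := d k.castSucc + 1) (j := d m.succ - 1)
      (L := c.attach.map g) hk.pos (by have := hk.2; omega) (by omega)
      (fun q hq => by
        obtain ⟨⟨p, hp⟩, _, rfl⟩ := List.mem_map.1 hq
        have h₁ : cornerElt d k ≤ p := ((List.pairwise_cons.1 hpair).1 p (by simp [hp])).le
        have h₂ : p ≤ cornerElt d m :=
          ((List.pairwise_append.1 (List.pairwise_cons.1 hpair).2).2.2 p hp _ (by simp)).le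
        exact ⟨(isSeparated_of_notMem (hc p hp)).fst_lt_snd, h₁.1, h₂.2.trans hj.ge⟩)
      (by
        have hcp := (List.pairwise_append.1 (List.pairwise_cons.1 hpair).2).1
        rw [← c.attach_map_subtype_val, List.pairwise_map] at hcp
        exact List.pairwise_map.2 (hcp.imp fun h => Subtype.mk_lt_mk.2 h))
    rw [hj] at this
    rw [hsum]
    push_cast
    linarith

end FFLV

/-! ### The pure order and pure chain cases, and conclusion -/

theorem removeBelow_union_compl {P : Type*} [PartialOrder P] (M : Set P) :
    removeBelow (M ∪ Mᶜ) = fun _ _ => False := by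
  funext p q
  simp [removeBelow]

theorem mrpp_trivial_eq_mcop {P : Type*} [PartialOrder P] [Finite P] {M : Set P} {lam : M → ℤ}
    (hM : IsMarkedSet M) (hlam : IsDominant lam) :
    mrpp M (fun _ _ => False) lam = mcop M ∅ Mᶜ lam := by
  rw [mcop_eq_mrpp hM hlam (Set.empty_disjoint _) (Set.empty_union _), removeBelow_union_compl]

theorem mrpp_removeBelow_eq_mcop {P : Type*} [PartialOrder P] [Finite P] {M : Set P} {lam : M → ℤ}
    (hM : IsMarkedSet M) (hlam : IsDominant lam) :
    mrpp M (removeBelow M) lam = mcop M Mᶜ ∅ lam := by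
  rw [mcop_eq_mrpp hM hlam (Set.disjoint_empty _) (Set.union_empty _), Set.union_empty]

end PosetPolytope

theorem mainTheorem12 :
    (∀ (P : Type*) [PartialOrder P] [Finite P] (M C O : Set P) (lam : M → ℤ),
      PosetPolytope.IsMarkedSet M → PosetPolytope.IsDominant lam →
      Disjoint C O → C ∪ O = Mᶜ →
        PosetPolytope.IsAdmissibleOrder M (PosetPolytope.removeBelow (M ∪ O)) ∧
        PosetPolytope.mcop M C O lam =
          PosetPolytope.mrpp M (PosetPolytope.removeBelow (M ∪ O)) lam ∧
        ∀ β : ℤ, (∀ p, 0 ≤ lam p + β) →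
          PosetPolytope.mcop M C O lam =
            PosetPolytope.mrppShifted M (PosetPolytope.removeBelow (M ∪ O)) lam β) ∧
    (∀ (n l : ℕ) (d : Fin (l + 1) → ℕ), 1 ≤ n → StrictMono d → d 0 = 0 → d (Fin.last l) = n →
        PosetPolytope.IsMarkedSet (PosetPolytope.flagMarked d) ∧
        PosetPolytope.IsDominant (PosetPolytope.flagMarking d) ∧
        PosetPolytope.IsAdmissibleOrder (PosetPolytope.flagMarked d) (fun _ _ => False) ∧
        PosetPolytope.IsAdmissibleOrder (PosetPolytope.flagMarked d)
          (PosetPolytope.removeBelow (PosetPolytope.flagMarked d)) ∧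
        PosetPolytope.mrpp (PosetPolytope.flagMarked d) (fun _ _ => False)
            (PosetPolytope.flagMarking d) =
          PosetPolytope.mcop (PosetPolytope.flagMarked d) ∅ (PosetPolytope.flagMarked d)ᶜ
            (PosetPolytope.flagMarking d) ∧
        PosetPolytope.mrpp (PosetPolytope.flagMarked d)
            (PosetPolytope.removeBelow (PosetPolytope.flagMarked d))
            (PosetPolytope.flagMarking d) =
          PosetPolytope.mcop (PosetPolytope.flagMarked d) (PosetPolytope.flagMarked d)ᶜ ∅
            (PosetPolytope.flagMarking d) ∧
        Set.BijOn
          (fun x : PosetPolytope.flagPoset d → ℝ =>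
            PosetPolytope.flagExtend (n := n) d
              (fun t => PosetPolytope.flagWeight d (t : ℕ × ℕ).1) (fun p => x p - 1))
          (PosetPolytope.mrpp (PosetPolytope.flagMarked d) (fun _ _ => False)
            (PosetPolytope.flagMarking d))
          (PosetPolytope.gtPolytope n (PosetPolytope.flagWeight d)) ∧
        Set.BijOn
          (PosetPolytope.flagExtend (n := n) d
            (fun t => if (t : ℕ × ℕ).1 = (t : ℕ × ℕ).2
              then (PosetPolytope.flagWeight d (t : ℕ × ℕ).1 : ℝ) else 0))
          (PosetPolytope.mrpp (PosetPolytope.flagMarked d)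
            (PosetPolytope.removeBelow (PosetPolytope.flagMarked d))
            (PosetPolytope.flagMarking d))
          (PosetPolytope.fflvPolytope n (PosetPolytope.flagWeight d))) := by
  refine ⟨fun P _ _ M C O lam hM hlam hCO hC =>
    ⟨PosetPolytope.isAdmissibleOrder_removeBelow Set.subset_union_left,
      PosetPolytope.mcop_eq_mrpp hM hlam hCO hC,
      fun β hβ => PosetPolytope.mcop_eq_mrppShifted hM hlam hCO hC hβ⟩,
    fun n l d _ hd h0 hn => ?_⟩
  have hM := PosetPolytope.isMarkedSet_flagMarked hd h0
  have hlam := PosetPolytope.isDominant_flagMarking hd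
  have hO := PosetPolytope.mrpp_trivial_eq_mcop hM hlam
  have hC := PosetPolytope.mrpp_removeBelow_eq_mcop hM hlam
  refine ⟨hM, hlam, ?_, PosetPolytope.isAdmissibleOrder_removeBelow subset_rfl, hO, hC, ?_, ?_⟩
  · rw [← PosetPolytope.removeBelow_union_compl (PosetPolytope.flagMarked d)]
    exact PosetPolytope.isAdmissibleOrder_removeBelow Set.subset_union_left
  · rw [hO]
    exact PosetPolytope.bijOn_gtPolytope hd h0 hn
  · rw [hC]
    exact PosetPolytope.bijOn_fflvPolytope hd h0 hn
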